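/- Let $G=(V,E,w)$ be a finite undirected graph with $n=|V|$ vertices, without loops (parallel edges are allowed), with edge weights $w_e>0$, and let $s,t\in V$ be joined by a path. Let $\rho\ge 1$ and $\varepsilon>0$. For each edge $e$ let $\Omega_e$ be a probability distribution supported on $[w_e,\rho w_e]$, and let $\mathcal D=\prod_e\Omega_e$. The actual graph is $G'=(V,E,w')$ with $w'\sim\mathcal D$; the weight $w'_e$ is learned only by probing $e$. Write $d_G$ for the shortest path distance in $G$. Algorithm (with a constant $c$): let $L=d_G(s,t)$; draw $w''\sim\mathcal D$ independently of $w'$; let $H$ be the subgraph of $(V,E,w'')$ induced by $\{v: d_G(s,v)\le\rho L\}$; for each edge $e$ of $H$ with $w_e>c\,\varepsilon^2L/(\rho^4\log n)$, probe $e$ and replace its weight in $H$ by $w'_e$; return $\hat\delta=d_H(s,t)$. The doubling dimension of a weighted graph is the least real $h$ such that each ball $\{v:d(u,v)\le r\}$ around a vertex $u$, $r>0$, is covered by at most $2^h$ balls of radius $r/2$ around vertices. The graph $G$ has continuous doubling dimension $h$ if the doubling dimension of $G_k$ tends to $h$ as $k\to\infty$, where $G_k$ is obtained from $G$ by replacing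 each edge $e$ with a path of $k$ edges of weight $w_e/k$ each. Theorem. For every constant $0<c\le 1/16$ there is a constant $C>0$, depending only on $c$, such that for all $G,s,t,\rho,\varepsilon,(\Omega_e)_e$ as above: (1) if $G$ has continuous doubling dimension $h$, and $n\ge 3$ and $\varepsilon\le 1$, then the algorithm always probes at most $\left(\frac{\rho\log n}{\varepsilon}\right)^{Ch}$ edges; (2) with probability at least $1-8\,n^{-1/(16c)}$ over $w'$ and $w''$ (in particular at least $1-8/n$ for $c=1/16$), the returned number is finite and satisfies $|\hat\delta-\delta|\le\varepsilon\delta$, where $\delta=d_{G'}(s,t)$. -/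

import Mathlib

open MeasureTheory Filter Topology
open scoped ENNReal

noncomputable section

/-- A weighted undirected graph with vertex set `V` and edge set `E`; parallel edges are allowed.
The endpoints of an edge are listed in an arbitrary order, and edges can be traversed in both
directions (see `Joins`). -/
structure WGraph (V E : Type*) where
  src : E → V
  tgt : E → V
  w : E → ℝ

namespace WGraph

variable {V E : Type*}

/-- The edge `e` has endpoints `u` and `v`. -/
def Joins (G : WGraph V E) (e : E) (u v : V) : Prop :=
  (G.src e = u ∧ G.tgt e = v) ∨ (G.src e = v ∧ G.tgt e = u)

/-- `G.IsWalk u p v`: the list of edges `p` is a walk from `u` to `v`. -/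
inductive IsWalk (G : WGraph V E) : V → List E → V → Prop
  | nil (v : V) : IsWalk G v [] v
  | cons {u v x : V} {e : E} {p : List E} :
      G.Joins e u v → IsWalk G v p x → IsWalk G u (e :: p) x

/-- The length of a list of edges. -/
def len (G : WGraph V E) (p : List E) : ℝ := (p.map G.w).sum

/-- The shortest path distance; it is `⊤` when there is no path. -/
def dist (G : WGraph V E) (u v : V) : ℝ≥0∞ :=
  ⨅ (p : List E) (_ : G.IsWalk u p v), ENNReal.ofReal (G.len p)

/-- The ball of radius `r` around `u`. -/
def ball (G : WGraph V E) (u : V) (r : ℝ) : Set V := {v | G.dist u v ≤ ENNReal.ofReal r}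

/-- The same graph with new edge weights. -/
def reweight (G : WGraph V E) (w : E → ℝ) : WGraph V E where
  src := G.src
  tgt := G.tgt
  w := w

/-- The edges with both endpoints in `S`. -/
def edgesIn (G : WGraph V E) (S : Set V) : Set E := {e | G.src e ∈ S ∧ G.tgt e ∈ S}

/-- The subgraph induced by `S`. Vertices outside of `S` are kept as isolated vertices, which does
not affect distances between vertices of `S`. -/
def induce (G : WGraph V E) (S : Set V) : WGraph V (G.edgesIn S) where
  src e := G.src e
  tgt e := G.tgt e
  w e := G.w e

/-! ### Doubling dimension and continuous doubling dimension -/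

/-- Every ball is covered by at most `2 ^ h` balls of half the radius. -/
def IsDoubling (G : WGraph V E) (h : ℝ) : Prop :=
  ∀ (u : V) (r : ℝ), 0 < r →
    ∃ S : Finset V, (S.card : ℝ) ≤ (2 : ℝ) ^ h ∧ G.ball u r ⊆ ⋃ v ∈ S, G.ball v (r / 2)

/-- The doubling dimension: the least `h` such that every ball is covered by at most `2 ^ h` balls
of half the radius. -/
def doublingDim (G : WGraph V E) : ℝ := sInf {h : ℝ | G.IsDoubling h}

/-- The `j`-th point on the path of length `k` which replaces `e`: the point `0` is `src e`, the
point `k` is `tgt e`, and the points `1, …, k - 1` are new vertices. -/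
def subdivPoint (G : WGraph V E) (k : ℕ) (e : E) (j : ℕ) : V ⊕ E × Fin (k - 1) :=
  if j = 0 then Sum.inl (G.src e)
  else if hj : j - 1 < k - 1 then Sum.inr (e, ⟨j - 1, hj⟩)
  else Sum.inl (G.tgt e)

/-- Each edge is replaced by a path of `k` edges, each of which has `1 / k` of its weight. -/
def subdivide (G : WGraph V E) (k : ℕ) : WGraph (V ⊕ E × Fin (k - 1)) (E × Fin k) where
  src x := G.subdivPoint k x.1 x.2
  tgt x := G.subdivPoint k x.1 (x.2 + 1)
  w x := G.w x.1 / k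

/-- `G` has continuous doubling dimension `h`: the doubling dimensions of its subdivisions
converge to `h`. -/
def HasCDD (G : WGraph V E) (h : ℝ) : Prop :=
  Tendsto (fun k : ℕ => (G.subdivide k).doublingDim) atTop (𝓝 h)

/-! ### The probing algorithm

The algorithm knows `G`, `s`, `t`, `ρ`, `ε`, the constant `c`, and a sample of edge weights of its
own. It learns the actual weight of an edge only by probing that edge. -/

section Algorithm

variable [Fintype V] (G : WGraph V E) (s t : V) (ρ ε c : ℝ)

/-- The vertices of the simulation graph: the ball of radius `ρ L` around `s` in `G`, where `L` is
the distance from `s` to `t` in `G`. -/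
def region : Set V := G.ball s (ρ * (G.dist s t).toReal)

/-- The probing threshold `c ε² L / (ρ⁴ log n)`. -/
def threshold : ℝ :=
  c * ε ^ 2 * (G.dist s t).toReal / (ρ ^ 4 * Real.log (Fintype.card V))

/-- The set of edges that the algorithm probes: the edges of the simulation graph whose weight in
`G` exceeds the threshold. -/
def probedEdges : Set E :=
  {e | e ∈ G.edgesIn (G.region s t ρ) ∧ G.threshold s t ρ ε c < G.w e}

open Classical in
/-- The simulation graph: the sampled graph induced on the region, in which the weights of the
probed edges are replaced by their actual weights. -/
def simulation (actual sample : E → ℝ) : WGraph V (G.edgesIn (G.region s t ρ)) :=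
  ((G.reweight sample).induce (G.region s t ρ)).reweight
    fun e => if (e : E) ∈ G.probedEdges s t ρ ε c then actual e else sample e

/-- The number that the algorithm returns. -/
def approximateLength (actual sample : E → ℝ) : ℝ≥0∞ :=
  (G.simulation s t ρ ε c actual sample).dist s t

end Algorithm

end WGraph

end

noncomputable section


/-! ### Maurey's convex property in one dimension and its tensorization -/

section ConvexTransport

/-! The two claims are independent.

Number of probes. In a fine subdivision, mark on each probed edge a point at distance between τ/4
and τ/2 from its source, where τ is the threshold. The distance to the ends of the edge, extended by
zero, is a 1-Lipschitz function that is at least τ/4 at the marked point of that edge and zero at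
all others. So a ball of radius less than τ/8 contains at most one marked point, while all of them
lie in a ball of radius ρL + τ. Iterating the doubling property covers that ball by few small balls
(`HasCDD.ncard_le`). Working in subdivisions is essential: parallel edges cannot be told apart by
distances in G itself.

Accuracy. As a function of the weights, the distance is a minimum of linear functions, one for each
edge set of a walk without repeated edges, hence concave (`minLen`). With the probed weights fixed,
the increase of the minimum from unprobed weights x to y is at most the change on a single minimizer
F at x. The weight of F in G is at most ρL, so F stays in the region, its unprobed edges have weight
at most τ, and the sum of their squared ranges is at most cε²L²/log n (`sum_sq_le`). A
bounded-difference estimate would sum over all edges; Talagrand-type concentration for convex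
functions charges only F. It is obtained here from Maurey's property for product measures: a
one-dimensional inequality (`maureyProperty_Icc`) and tensorization (`MaureyProperty.prod`),
followed by Markov's inequality (`MaureyProperty.measure_le`).

The actual and the simulated weights agree on probed edges, so their comparison is one between two
independent samples of the unprobed weights. A deviation of εL is enough, because L ≤ δ. -/

/-- Maurey's convex property: `q` is a cost on `K` for which the exponential moments of a convex
function `φ` and of its infimal convolution with `q` are in duality. -/
def MaureyProperty {X : Type*} [AddCommGroup X] [Module ℝ X] [TopologicalSpace X]
    [MeasurableSpace X] (μ : Measure X) (K : Set X) (q : X → ℝ) : Prop :=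
  ∀ φ g : X → ℝ, ConvexOn ℝ Set.univ φ → Continuous g →
    (∀ x ∈ K, ∀ y ∈ K, g x ≤ φ y + q (x - y)) →
    (∫ x, Real.exp (g x) ∂μ) * ∫ x, Real.exp (-φ x) ∂μ ≤ 1

theorem integrable_of_continuous_of_ae_mem {X : Type*} [TopologicalSpace X] [T2Space X]
    [MeasurableSpace X] [OpensMeasurableSpace X] {μ : Measure X} [IsFiniteMeasure μ] {K : Set X}
    (hK : IsCompact K) (hμ : ∀ᵐ x ∂μ, x ∈ K) {f : X → ℝ} (hf : Continuous f) :
    Integrable f μ := by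
  rw [← Measure.restrict_eq_self_of_ae_mem hμ]
  exact hf.continuousOn.integrableOn_compact hK

/-- The scalar inequality behind the one-dimensional property: u is the excess of a convex function
over its minimum, θ the fraction of the way moved towards the minimizer, and θ²/16 the price of the
move. -/
theorem exp_sub_sq_le {u : ℝ} (hu : 0 ≤ u) :
    ∃ θ : ℝ, 0 ≤ θ ∧ θ ≤ 1 ∧
      Real.exp ((1 - θ) * u + θ ^ 2 / 16) ≤ 2 - Real.exp (-u) := by
  rcases le_total u (1 / 8) with h | h
  -- θ = 8u minimizes the exponent; it is admissible up to u = 1/8, beyond which θ = 1 suffices.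
  · refine ⟨8 * u, by linarith, by linarith, ?_⟩
    have h1 : |u - 4 * u ^ 2| ≤ 1 := abs_le.2 ⟨by nlinarith, by nlinarith⟩
    have h2 : |-u| ≤ 1 := abs_le.2 ⟨by linarith, by linarith⟩
    have h3 := (abs_le.1 (Real.abs_exp_sub_one_sub_id_le h1)).2
    have h4 := (abs_le.1 (Real.abs_exp_sub_one_sub_id_le h2)).2
    have h5 : (1 - 8 * u) * u + (8 * u) ^ 2 / 16 = u - 4 * u ^ 2 := by ring
    have h6 : (u - 4 * u ^ 2) ^ 2 ≤ u ^ 2 :=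
      pow_le_pow_left₀ (by nlinarith) (by nlinarith [sq_nonneg u]) 2
    rw [h5]
    nlinarith
  · refine ⟨1, by norm_num, le_rfl, ?_⟩
    have h1 : |(1 / 16 : ℝ)| ≤ 1 := by norm_num [abs_le]
    have h2 : |(-(1 / 8) : ℝ)| ≤ 1 := by norm_num [abs_le]
    have h3 := (abs_le.1 (Real.abs_exp_sub_one_sub_id_le h1)).2
    have h4 := (abs_le.1 (Real.abs_exp_sub_one_sub_id_le h2)).2
    have h5 : Real.exp (-u) ≤ Real.exp (-(1 / 8)) := Real.exp_le_exp.2 (by linarith)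
    norm_num at h3 h4 ⊢
    linarith

/-- Moving x towards a minimizer m of φ bounds exp (g x) by a(2 - a exp (-φ x)) with a = exp (φ m).
Integration leaves aA(2 - aA) ≤ 1, where A is the moment of -φ. -/
theorem maureyProperty_Icc {μ : Measure ℝ} [IsProbabilityMeasure μ] {a b l : ℝ} (hab : a ≤ b)
    (hl : 0 < l) (hl' : b - a ≤ l) (hμ : ∀ᵐ x ∂μ, x ∈ Set.Icc a b) :
    MaureyProperty μ (Set.Icc a b) (fun x => (x / l) ^ 2 / 16) := by
  intro φ g hφ hg hgφ
  have hφc : Continuous φ := hφ.locallyLipschitz.continuous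
  obtain ⟨m, hm, hmin⟩ := (isCompact_Icc (a := a) (b := b)).exists_isMinOn ⟨a, le_rfl, hab⟩
    hφc.continuousOn
  have hint : ∀ f : ℝ → ℝ, Continuous f → Integrable f μ := fun f hf =>
    integrable_of_continuous_of_ae_mem isCompact_Icc hμ hf
  have key : ∀ x ∈ Set.Icc a b,
      Real.exp (g x) ≤ Real.exp (φ m) * (2 - Real.exp (φ m) * Real.exp (-φ x)) := by
    intro x hx
    obtain ⟨θ, h0, h1, hθ⟩ := exp_sub_sq_le (sub_nonneg.2 (hmin hx))
    have hy : (1 - θ) * x + θ * m ∈ Set.Icc a b :=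
      convex_Icc a b hx hm (sub_nonneg.2 h1) h0 (by ring)
    have h2 := hgφ x hx _ hy
    have h3 : φ ((1 - θ) * x + θ * m) ≤ (1 - θ) * φ x + θ * φ m :=
      hφ.2 (Set.mem_univ x) (Set.mem_univ m) (sub_nonneg.2 h1) h0 (by ring)
    have h4 : ((x - ((1 - θ) * x + θ * m)) / l) ^ 2 ≤ θ ^ 2 := by
      have : (x - ((1 - θ) * x + θ * m)) / l = θ * ((x - m) / l) := by ring
      rw [this, mul_pow]
      have : ((x - m) / l) ^ 2 ≤ 1 := by
        rw [sq_le_one_iff_abs_le_one, abs_div, abs_of_pos hl, div_le_one hl, abs_le]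
        constructor <;> linarith [hx.1, hx.2, hm.1, hm.2]
      nlinarith [sq_nonneg θ]
    calc Real.exp (g x) ≤ Real.exp (φ m + ((1 - θ) * (φ x - φ m) + θ ^ 2 / 16)) :=
          Real.exp_le_exp.2 (by linarith)
      _ = Real.exp (φ m) * Real.exp ((1 - θ) * (φ x - φ m) + θ ^ 2 / 16) := Real.exp_add _ _
      _ ≤ Real.exp (φ m) * (2 - Real.exp (-(φ x - φ m))) := by gcongr
      _ = _ := by rw [← Real.exp_add, neg_sub, sub_eq_add_neg (φ m)]
  set A := ∫ x, Real.exp (-φ x) ∂μ with hA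
  have hA0 : 0 ≤ A := integral_nonneg fun x => (Real.exp_pos _).le
  have h1 : ∫ x, Real.exp (g x) ∂μ ≤ Real.exp (φ m) * (2 - Real.exp (φ m) * A) := by
    calc ∫ x, Real.exp (g x) ∂μ
        ≤ ∫ x, Real.exp (φ m) * (2 - Real.exp (φ m) * Real.exp (-φ x)) ∂μ :=
          integral_mono_ae (hint _ (by fun_prop)) (hint _ (by fun_prop))
            (hμ.mono key)
      _ = _ := by
          rw [integral_const_mul, integral_sub (hint _ (by fun_prop)) (hint _ (by fun_prop)),
            integral_const_mul, ← hA]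
          simp
  calc (∫ x, Real.exp (g x) ∂μ) * A ≤ Real.exp (φ m) * (2 - Real.exp (φ m) * A) * A := by gcongr
    _ ≤ 1 := by nlinarith [sq_nonneg (Real.exp (φ m) * A - 1)]

section InfConv

variable {X Y : Type*} [NormedAddCommGroup X] [NormedSpace ℝ X] [AddCommGroup Y] [Module ℝ Y]

/-- A partial minimum of a jointly convex function is convex. -/
theorem convexOn_sInf_image {K : Set X} (hK : IsCompact K) (hKc : Convex ℝ K) (hne : K.Nonempty)
    {Φ : X × Y → ℝ} (hΦ : ConvexOn ℝ Set.univ Φ) (hc : ∀ y, Continuous fun x => Φ (x, y)) :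
    ConvexOn ℝ Set.univ fun y => sInf ((fun x => Φ (x, y)) '' K) := by
  refine ⟨convex_univ, fun y _ y' _ s t hs ht hst => ?_⟩
  obtain ⟨x, hx, hxy⟩ := hK.exists_sInf_image_eq hne (hc y).continuousOn
  obtain ⟨x', hx', hxy'⟩ := hK.exists_sInf_image_eq hne (hc y').continuousOn
  simp only [hxy, hxy']
  refine (csInf_le (hK.bddBelow_image (hc _).continuousOn)
    ⟨s • x + t • x', hKc hx hx' hs ht hst, rfl⟩).trans ?_
  exact hΦ.2 (Set.mem_univ (x, y)) (Set.mem_univ (x', y')) hs ht hst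

end InfConv

/-- The logarithm of an exponential moment of a family of convex functions is convex. -/
theorem convexOn_log_integral_exp {X Y : Type*} [MeasurableSpace X] [AddCommGroup Y] [Module ℝ Y]
    {μ : Measure X} [IsProbabilityMeasure μ] {u : X → Y → ℝ}
    (hu : ∀ x, ConvexOn ℝ Set.univ (u x))
    (hi : ∀ y, Integrable (fun x => Real.exp (u x y)) μ) :
    ConvexOn ℝ Set.univ fun y => Real.log (∫ x, Real.exp (u x y) ∂μ) := by
  refine ⟨convex_univ, fun y _ y' _ s t hs ht hst => ?_⟩
  have hpos : ∀ y, 0 < ∫ x, Real.exp (u x y) ∂μ := fun y => integral_exp_pos (hi y)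
  set A := Real.log (∫ x, Real.exp (u x y) ∂μ) with hA
  set B := Real.log (∫ x, Real.exp (u x y') ∂μ) with hB
  -- With both moments normalized to 1, pointwise convexity of exp takes the place of Hölder's
  -- inequality.
  have hA' : Real.exp (-A) * ∫ x, Real.exp (u x y) ∂μ = 1 := by
    rw [Real.exp_neg, hA, Real.exp_log (hpos y), inv_mul_cancel₀ (hpos y).ne']
  have hB' : Real.exp (-B) * ∫ x, Real.exp (u x y') ∂μ = 1 := by
    rw [Real.exp_neg, hB, Real.exp_log (hpos y'), inv_mul_cancel₀ (hpos y').ne']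
  rw [Real.log_le_iff_le_exp (hpos _)]
  have h1 : ∀ x, Real.exp (u x (s • y + t • y')) ≤ Real.exp (s • A + t • B) *
      (s * (Real.exp (-A) * Real.exp (u x y)) + t * (Real.exp (-B) * Real.exp (u x y'))) := by
    intro x
    have h2 := (hu x).2 (Set.mem_univ y) (Set.mem_univ y') hs ht hst
    have h3 := convexOn_exp.2 (Set.mem_univ (-A + u x y)) (Set.mem_univ (-B + u x y')) hs ht hst
    simp only [smul_eq_mul] at h2 h3 ⊢
    rw [← Real.exp_add, ← Real.exp_add]
    calc Real.exp (u x (s • y + t • y')) ≤ Real.exp ((s * A + t * B) +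
          (s * (-A + u x y) + t * (-B + u x y'))) := Real.exp_le_exp.2 (by linarith)
      _ = Real.exp (s * A + t * B) * Real.exp (s * (-A + u x y) + t * (-B + u x y')) :=
          Real.exp_add _ _
      _ ≤ _ := by gcongr
  refine (integral_mono (hi _) ?_ h1).trans_eq ?_
  · exact ((((hi y).const_mul _).const_mul _).add (((hi y').const_mul _).const_mul _)).const_mul _
  · rw [integral_const_mul, integral_add (((hi y).const_mul _).const_mul _)
      (((hi y').const_mul _).const_mul _), integral_const_mul, integral_const_mul,
      integral_const_mul, integral_const_mul, hA', hB', mul_one, mul_one, hst, mul_one]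

section Prod

variable {X Y : Type*} [NormedAddCommGroup X] [NormedSpace ℝ X] [FiniteDimensional ℝ X]
  [MeasurableSpace X] [BorelSpace X] [NormedAddCommGroup Y] [NormedSpace ℝ Y]
  [FiniteDimensional ℝ Y] [MeasurableSpace Y] [BorelSpace Y]

omit [MeasurableSpace Y] [BorelSpace Y] in
theorem continuous_integral_of_ae_mem {μ : Measure X} [IsFiniteMeasure μ] {K : Set X}
    (hK : IsCompact K) (hμ : ∀ᵐ x ∂μ, x ∈ K) {f : X × Y → ℝ} (hf : Continuous f) :
    Continuous fun y => ∫ x, f (x, y) ∂μ := by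
  have := FiniteDimensional.proper_real Y
  have : SecondCountableTopology Y := secondCountable_of_proper
  have : Continuous (Function.uncurry fun (y : Y) (x : X) => f (x, y)) := by
    simp only [Function.uncurry_def]; fun_prop
  simpa [Measure.restrict_eq_self_of_ae_mem hμ] using
    continuous_parametric_integral_of_continuous (μ := μ) this hK

/-- Infimal convolution in the first variable gives Q, and ψ is the log-moment of Q over that
variable. The property of μ on each slice bounds the moment of -φ by exp (-ψ); the property of ν
then applies to ψ and the log-moment of g. This requires ψ to be convex, which is where joint
convexity of Q, and so convexity of q, enters. -/
theorem MaureyProperty.prod {μ : Measure X} [IsProbabilityMeasure μ] {ν : Measure Y}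
    [IsProbabilityMeasure ν] {K : Set X} {K' : Set Y} {q : X → ℝ} {q' : Y → ℝ}
    (hK : IsCompact K) (hKc : Convex ℝ K) (hKn : K.Nonempty) (hμ : ∀ᵐ x ∂μ, x ∈ K)
    (hK' : IsCompact K') (hν : ∀ᵐ y ∂ν, y ∈ K') (hq : ConvexOn ℝ Set.univ q)
    (h : MaureyProperty μ K q) (h' : MaureyProperty ν K' q') :
    MaureyProperty (μ.prod ν) (K ×ˢ K') (fun p => q p.1 + q' p.2) := by
  have := FiniteDimensional.proper_real X
  have := FiniteDimensional.proper_real Y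
  have : SecondCountableTopology X := secondCountable_of_proper
  have : SecondCountableTopology Y := secondCountable_of_proper
  intro φ g hφ hg hgφ
  have hφc : Continuous φ := hφ.locallyLipschitz.continuous
  have hqc : Continuous q := hq.locallyLipschitz.continuous
  have hprod : ∀ᵐ p ∂μ.prod ν, p ∈ K ×ˢ K' := by
    have h1 : ∀ᵐ p ∂μ.prod ν, p.1 ∈ K := Measure.quasiMeasurePreserving_fst.ae hμ
    have h2 : ∀ᵐ p ∂μ.prod ν, p.2 ∈ K' := Measure.quasiMeasurePreserving_snd.ae hν
    filter_upwards [h1, h2] with p hp hp' using ⟨hp, hp'⟩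
  have hiX : ∀ f : X → ℝ, Continuous f → Integrable f μ := fun f hf =>
    integrable_of_continuous_of_ae_mem hK hμ hf
  have hiY : ∀ f : Y → ℝ, Continuous f → Integrable f ν := fun f hf =>
    integrable_of_continuous_of_ae_mem hK' hν hf
  have hiP : ∀ f : X × Y → ℝ, Continuous f → Integrable f (μ.prod ν) := fun f hf =>
    integrable_of_continuous_of_ae_mem (hK.prod hK') hprod hf
  let Φ : X × (X × Y) → ℝ := fun p => φ (p.1, p.2.2) + q (p.2.1 - p.1)
  have hΦ : ConvexOn ℝ Set.univ Φ := by
    refine ⟨convex_univ, fun p _ p' _ s t hs ht hst => ?_⟩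
    have h1 := hφ.2 (Set.mem_univ (p.1, p.2.2)) (Set.mem_univ (p'.1, p'.2.2)) hs ht hst
    have h2 := hq.2 (Set.mem_univ (p.2.1 - p.1)) (Set.mem_univ (p'.2.1 - p'.1)) hs ht hst
    have h3 : s • (p.2.1 - p.1) + t • (p'.2.1 - p'.1) =
        (s • p.2.1 + t • p'.2.1) - (s • p.1 + t • p'.1) := by module
    rw [h3] at h2
    simp only [smul_eq_mul, Prod.smul_mk, Prod.mk_add_mk, Φ, Prod.fst_add, Prod.snd_add,
      Prod.smul_fst, Prod.smul_snd] at h1 h2 ⊢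
    linarith
  have hΦc : Continuous Φ := by fun_prop
  let Q : X × Y → ℝ := fun p => sInf ((fun x => Φ (x, p)) '' K)
  have hQ : ConvexOn ℝ Set.univ Q :=
    convexOn_sInf_image hK hKc hKn hΦ fun p => hΦc.comp (by fun_prop)
  have hQc : Continuous Q := hQ.locallyLipschitz.continuous
  have hQle : ∀ p, ∀ x ∈ K, Q p ≤ Φ (x, p) := fun p x hx =>
    csInf_le (hK.bddBelow_image (hΦc.comp (by fun_prop : Continuous fun x => (x, p))).continuousOn)
      ⟨x, hx, rfl⟩
  let ψ : Y → ℝ := fun y => Real.log (∫ x, Real.exp (Q (x, y)) ∂μ)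
  have hQe : ∀ y, Integrable (fun x => Real.exp (Q (x, y))) μ := fun y => hiX _ (by fun_prop)
  have hψ : ConvexOn ℝ Set.univ ψ := by
    refine convexOn_log_integral_exp (u := fun x y => Q (x, y)) (fun x => ?_) hQe
    refine ⟨convex_univ, fun y _ y' _ s t hs ht hst => ?_⟩
    have h1 := hQ.2 (Set.mem_univ (x, y)) (Set.mem_univ (x, y')) hs ht hst
    rwa [Prod.smul_mk, Prod.smul_mk, Prod.mk_add_mk, ← add_smul, hst, one_smul] at h1
  have hge : ∀ y, Integrable (fun x => Real.exp (g (x, y))) μ := fun y => hiX _ (by fun_prop)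
  have hgc : Continuous fun y => ∫ x, Real.exp (g (x, y)) ∂μ :=
    continuous_integral_of_ae_mem hK hμ (f := fun p => Real.exp (g p)) (by fun_prop)
  let g' : Y → ℝ := fun y => Real.log (∫ x, Real.exp (g (x, y)) ∂μ)
  have hg' : Continuous g' := hgc.log fun y => (integral_exp_pos (hge y)).ne'
  have key := h' ψ g' hψ hg' fun y hy z hz => by
    rw [Real.log_le_iff_le_exp (integral_exp_pos (hge y)), Real.exp_add,
      Real.exp_log (integral_exp_pos (hQe z)), ← integral_mul_const]
    refine integral_mono_ae (hge y) ((hQe z).mul_const _) ?_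
    filter_upwards [hμ] with x hx
    rw [← Real.exp_add, Real.exp_le_exp, ← sub_le_iff_le_add]
    refine le_csInf (hKn.image _) ?_
    rintro _ ⟨x', hx', rfl⟩
    have := hgφ (x, y) ⟨hx, hy⟩ (x', z) ⟨hx', hz⟩
    simp only [Φ, Prod.mk_sub_mk] at this ⊢
    linarith
  have hφe : Continuous fun y => ∫ x, Real.exp (-φ (x, y)) ∂μ :=
    continuous_integral_of_ae_mem hK hμ (f := fun p => Real.exp (-φ p)) (by fun_prop)
  have e1 : ∫ p, Real.exp (g p) ∂μ.prod ν = ∫ y, Real.exp (g' y) ∂ν := by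
    rw [integral_prod_symm _ (hiP _ (by fun_prop))]
    simp only [g', Real.exp_log (integral_exp_pos (hge _))]
  have e2 : ∫ p, Real.exp (-φ p) ∂μ.prod ν ≤ ∫ y, Real.exp (-ψ y) ∂ν := by
    rw [integral_prod_symm _ (hiP _ (by fun_prop))]
    refine integral_mono (hiY _ hφe) (hiY _ ?_) fun y => ?_
    · exact Real.continuous_exp.comp (hψ.locallyLipschitz.continuous).neg
    · simp only [ψ, Real.exp_neg, Real.exp_log (integral_exp_pos (hQe y))]
      rw [inv_eq_one_div, le_div_iff₀' (integral_exp_pos (hQe y))]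
      simp only [← Real.exp_neg]
      refine h (fun x => φ (x, y)) (fun x => Q (x, y)) ?_ (by fun_prop) ?_
      · refine ⟨convex_univ, fun x _ x' _ s t hs ht hst => ?_⟩
        have h1 := hφ.2 (Set.mem_univ (x, y)) (Set.mem_univ (x', y)) hs ht hst
        rwa [Prod.smul_mk, Prod.smul_mk, Prod.mk_add_mk, ← add_smul, hst, one_smul] at h1
      · intro x _ x' hx'
        exact hQle (x, y) x' hx'
  calc _ ≤ (∫ y, Real.exp (g' y) ∂ν) * ∫ y, Real.exp (-ψ y) ∂ν := by
        rw [e1]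
        exact mul_le_mul_of_nonneg_left e2 (integral_nonneg fun y => (Real.exp_pos _).le)
    _ ≤ 1 := key

omit [BorelSpace X] [FiniteDimensional ℝ Y] [BorelSpace Y] in
/-- Maurey's property is invariant under linear isomorphisms. -/
theorem MaureyProperty.of_map {μ : Measure X} {ν : Measure Y} {K : Set X} {K' : Set Y}
    {q : X → ℝ} {q' : Y → ℝ} (h : MaureyProperty μ K q) (e : X →ₗ[ℝ] Y)
    (he : MeasurePreserving e μ ν) (hem : MeasurableEmbedding e) (hK : ∀ x ∈ K, e x ∈ K')
    (hq : ∀ x, q' (e x) = q x) : MaureyProperty ν K' q' := by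
  intro φ g hφ hg hgφ
  have := h (φ ∘ e) (g ∘ e) (hφ.comp_linearMap e)
    (hg.comp (LinearMap.continuous_of_finiteDimensional e)) fun x hx y hy => by
      simpa [← hq] using hgφ _ (hK x hx) _ (hK y hy)
  rwa [← he.integral_comp hem, ← he.integral_comp hem]

end Prod

end ConvexTransport
end

noncomputable section


/-! ### Product measures and the resulting concentration inequality -/

section ConvexTransportPi

theorem ae_mem_univ_pi {ι : Type*} [Fintype ι] {D : ι → Measure ℝ}
    [∀ i, IsProbabilityMeasure (D i)] {s : ι → Set ℝ} (hD : ∀ i, ∀ᵐ x ∂D i, x ∈ s i) :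
    ∀ᵐ x ∂Measure.pi D, x ∈ Set.pi Set.univ s := by
  have : ∀ᵐ x ∂Measure.pi D, ∀ i, x i ∈ s i :=
    eventually_all.2 fun i => (Measure.quasiMeasurePreserving_eval D i).ae (hD i)
  exact this.mono fun x hx i _ => hx i

theorem maureyProperty_pi_fin {n : ℕ} (D : Fin n → Measure ℝ) [∀ i, IsProbabilityMeasure (D i)]
    {a b l : Fin n → ℝ} (hab : ∀ i, a i ≤ b i) (hl : ∀ i, 0 < l i) (hl' : ∀ i, b i - a i ≤ l i)
    (hD : ∀ i, ∀ᵐ x ∂D i, x ∈ Set.Icc (a i) (b i)) :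
    MaureyProperty (Measure.pi D) (Set.pi Set.univ fun i => Set.Icc (a i) (b i))
      (fun x => ∑ i, (x i / l i) ^ 2 / 16) := by
  induction n with
  | zero =>
    intro φ g _ _ h
    have h0 := h 0 (by simp) 0 (by simp)
    simp only [Finset.univ_eq_empty, Finset.sum_empty, add_zero] at h0
    have hg : ∀ x, g x = g 0 := fun x => by rw [Subsingleton.elim x 0]
    have hφ : ∀ x, φ x = φ 0 := fun x => by rw [Subsingleton.elim x 0]
    simp only [hg, hφ, integral_const, probReal_univ, one_smul]
    rw [← Real.exp_add, Real.exp_le_one_iff]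
    linarith
  | succ n ih =>
    have h0 := maureyProperty_Icc (hab 0) (hl 0) (hl' 0) (hD 0)
    have h1 := ih (fun i => D i.succ) (fun i => hab i.succ) (fun i => hl i.succ)
      (fun i => hl' i.succ) (fun i => hD i.succ)
    have hq : ConvexOn ℝ Set.univ fun x : ℝ => (x / l 0) ^ 2 / 16 := by
      have : ConvexOn ℝ Set.univ fun x : ℝ => (1 / (16 * l 0 ^ 2)) • x ^ 2 :=
        (Even.convexOn_pow (by norm_num : Even 2)).smul (by positivity)
      refine this.congr fun x _ => ?_
      have := (hl 0).ne'
      simp only [smul_eq_mul]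
      field_simp
    have h2 := h0.prod isCompact_Icc (convex_Icc _ _) (Set.nonempty_Icc.2 (hab 0)) (hD 0)
      (isCompact_univ_pi fun i => isCompact_Icc)
      (ae_mem_univ_pi (D := fun i => D (Fin.succ i)) fun i => hD i.succ) hq h1
    have hmp := (measurePreserving_piFinSuccAbove D 0).symm
    have he : ⇑(MeasurableEquiv.piFinSuccAbove (fun _ : Fin (n + 1) => ℝ) 0).symm =
        Fin.consLinearEquiv ℝ (fun _ : Fin (n + 1) => ℝ) := by
      ext p i
      refine Fin.cases ?_ (fun j => ?_) i <;> simp [MeasurableEquiv.piFinSuccAbove]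
    refine h2.of_map (Fin.consLinearEquiv ℝ (fun _ : Fin (n + 1) => ℝ)).toLinearMap
      (he ▸ hmp) (he ▸ MeasurableEquiv.measurableEmbedding _) ?_ ?_
    · rintro ⟨x, y⟩ ⟨hx, hy⟩ i _
      refine Fin.cases ?_ (fun j => ?_) i
      · simpa using hx
      · simpa using hy j (Set.mem_univ j)
    · rintro ⟨x, y⟩
      simp [Fin.sum_univ_succ]

theorem maureyProperty_pi {ι : Type*} [Fintype ι] (D : ι → Measure ℝ)
    [∀ i, IsProbabilityMeasure (D i)]
    {a b l : ι → ℝ} (hab : ∀ i, a i ≤ b i) (hl : ∀ i, 0 < l i) (hl' : ∀ i, b i - a i ≤ l i)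
    (hD : ∀ i, ∀ᵐ x ∂D i, x ∈ Set.Icc (a i) (b i)) :
    MaureyProperty (Measure.pi D) (Set.pi Set.univ fun i => Set.Icc (a i) (b i))
      (fun x => ∑ i, (x i / l i) ^ 2 / 16) := by
  let e := (Fintype.equivFin ι).symm
  have h := maureyProperty_pi_fin (fun i => D (e i)) (fun i => hab (e i)) (fun i => hl (e i))
    (fun i => hl' (e i)) (fun i => hD (e i))
  refine h.of_map (LinearEquiv.piCongrLeft ℝ (fun _ => ℝ) e).toLinearMap
    (measurePreserving_piCongrLeft D e)
    (MeasurableEquiv.piCongrLeft (fun _ => ℝ) e).measurableEmbedding ?_ ?_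
  · intro x hx i _
    obtain ⟨j, rfl⟩ := e.surjective i
    have : (LinearEquiv.piCongrLeft ℝ (fun _ => ℝ) e) x (e j) = x j :=
      Equiv.piCongrLeft_apply_apply (P := fun _ => ℝ) e x j
    simpa [this] using hx j (Set.mem_univ j)
  · intro x
    rw [← e.sum_comp]
    refine Finset.sum_congr rfl fun j _ => ?_
    have : (LinearEquiv.piCongrLeft ℝ (fun _ => ℝ) e) x (e j) = x j :=
      Equiv.piCongrLeft_apply_apply (P := fun _ => ℝ) e x j
    simp [this]

/-- The values of a convex function at two independent random points are close to each other if the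
function varies slowly in comparison with the cost. -/
theorem MaureyProperty.measure_le {X : Type*} [NormedAddCommGroup X] [NormedSpace ℝ X]
    [FiniteDimensional ℝ X] [MeasurableSpace X] [BorelSpace X] {μ : Measure X}
    [IsProbabilityMeasure μ] {K : Set X} {q : X → ℝ} (h : MaureyProperty μ K q)
    (hK : IsCompact K) (hμ : ∀ᵐ x ∂μ, x ∈ K) {φ : X → ℝ} (hφ : ConvexOn ℝ Set.univ φ) {σ : ℝ}
    (hσ : ∀ x ∈ K, ∀ y ∈ K, φ x - σ ≤ φ y + q (x - y)) (r : ℝ) :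
    (μ.prod μ) {p | r ≤ φ p.1 - φ p.2} ≤ ENNReal.ofReal (Real.exp (σ - r)) := by
  have hφc : Continuous φ := hφ.locallyLipschitz.continuous
  -- The choice g = φ - σ bounds the exponential moment of φ(X) - φ(Y), for independent X and Y, by
  -- exp σ.
  have h1 := h φ (fun x => φ x - σ) hφ (by fun_prop) hσ
  have hint : ∀ f : X → ℝ, Continuous f → Integrable f μ := fun f hf =>
    integrable_of_continuous_of_ae_mem hK hμ hf
  have h2 : ∫ p, Real.exp (φ p.1) * Real.exp (-φ p.2) ∂μ.prod μ ≤ Real.exp σ := by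
    rw [integral_prod_mul (fun x => Real.exp (φ x)) (fun x => Real.exp (-φ x))]
    simp only [Real.exp_sub] at h1
    rw [integral_div, div_mul_eq_mul_div, div_le_one (Real.exp_pos _)] at h1
    exact h1
  have h3 := mul_meas_ge_le_integral_of_nonneg (μ := μ.prod μ)
    (f := fun p => Real.exp (φ p.1) * Real.exp (-φ p.2))
    (ae_of_all _ fun p => by positivity)
    ((hint (fun x => Real.exp (φ x)) (by fun_prop)).mul_prod
      (hint (fun x => Real.exp (-φ x)) (by fun_prop))) (Real.exp r)
  have h4 : {p : X × X | Real.exp r ≤ Real.exp (φ p.1) * Real.exp (-φ p.2)} =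
      {p | r ≤ φ p.1 - φ p.2} := by
    ext p
    simp only [Set.mem_ofPred_eq]
    rw [← Real.exp_add, Real.exp_le_exp, sub_eq_add_neg]
  rw [h4] at h3
  rw [← ofReal_measureReal]
  refine ENNReal.ofReal_le_ofReal ?_
  rw [Real.exp_sub, le_div_iff₀' (Real.exp_pos r)]
  exact h3.trans h2

end ConvexTransportPi
end

noncomputable section

namespace WGraph

/-! ### Walks, lengths and distances -/

section Walks

variable {V E : Type*} {G : WGraph V E}

theorem Joins.symm {e : E} {u v : V} (h : G.Joins e u v) : G.Joins e v u := Or.symm h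

theorem joins_src_tgt (G : WGraph V E) (e : E) : G.Joins e (G.src e) (G.tgt e) := Or.inl ⟨rfl, rfl⟩

theorem IsWalk.append {u v x : V} {p q : List E} (hp : G.IsWalk u p v) (hq : G.IsWalk v q x) :
    G.IsWalk u (p ++ q) x := by
  induction hp with
  | nil => exact hq
  | cons h _ ih => exact .cons h (ih hq)

theorem isWalk_cons_iff {u x : V} {e : E} {p : List E} :
    G.IsWalk u (e :: p) x ↔ ∃ v, G.Joins e u v ∧ G.IsWalk v p x := by
  constructor
  · rintro (_ | ⟨h, h'⟩)
    exact ⟨_, h, h'⟩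
  · rintro ⟨v, h, h'⟩
    exact .cons h h'

theorem IsWalk.exists_of_append {u x : V} {p q : List E} (h : G.IsWalk u (p ++ q) x) :
    ∃ v, G.IsWalk u p v ∧ G.IsWalk v q x := by
  induction p generalizing u with
  | nil => exact ⟨u, .nil u, h⟩
  | cons e p ih =>
    obtain ⟨v, hv, h⟩ := isWalk_cons_iff.1 h
    obtain ⟨y, hy, h⟩ := ih h
    exact ⟨y, .cons hv hy, h⟩

theorem IsWalk.reweight {u v : V} {p : List E} (h : G.IsWalk u p v) (w : E → ℝ) :
    (G.reweight w).IsWalk u p v := by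
  induction h with
  | nil => exact .nil _
  | cons h _ ih => exact .cons h ih

theorem IsWalk.of_reweight {u v : V} {p : List E} {w : E → ℝ}
    (h : (G.reweight w).IsWalk u p v) : G.IsWalk u p v :=
  h.reweight G.w

/-- Every walk contains a walk with the same ends that uses no edge twice. -/
theorem IsWalk.exists_nodup {u v : V} {p : List E} (h : G.IsWalk u p v) :
    ∃ q, G.IsWalk u q v ∧ q.Nodup ∧ q.Sublist p := by
  induction h with
  | nil v => exact ⟨[], .nil v, List.nodup_nil, List.Sublist.refl _⟩
  | @cons u v x e p huv _ ih =>
    obtain ⟨q, hq, hn, hs⟩ := ih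
    by_cases he : e ∈ q
    · obtain ⟨a, b, rfl⟩ := List.append_of_mem he
      obtain ⟨y, -, hy⟩ := hq.exists_of_append
      have hn' : (e :: b).Nodup := (List.nodup_append.1 hn).2.1
      have hs' : (e :: b).Sublist (e :: p) :=
        ((List.sublist_append_right a (e :: b)).trans hs).cons e
      by_cases hyu : y = u
      · subst hyu
        exact ⟨e :: b, hy, hn', hs'⟩
      -- Here the later use of e runs from v back to u, so both uses are dropped together with what
      -- lies between them.
      · obtain ⟨z, hz, hb⟩ := isWalk_cons_iff.1 hy
        have : z = u := by
          rcases huv with ⟨h1, h2⟩ | ⟨h1, h2⟩ <;> rcases hz with ⟨h3, h4⟩ | ⟨h3, h4⟩ <;> grind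
        subst this
        exact ⟨b, hb, hn'.of_cons, (List.sublist_cons_self e b).trans hs'⟩
    · exact ⟨e :: q, .cons huv hq, List.nodup_cons.2 ⟨he, hn⟩, hs.cons_cons e⟩

theorem len_cons (e : E) (p : List E) : G.len (e :: p) = G.w e + G.len p := by simp [len]

theorem len_append (p q : List E) : G.len (p ++ q) = G.len p + G.len q := by simp [len]

theorem len_nonneg (hw : ∀ e, 0 ≤ G.w e) (p : List E) : 0 ≤ G.len p :=
  List.sum_nonneg (by simpa using fun e _ => hw e)

theorem dist_le_len {u v : V} {p : List E} (h : G.IsWalk u p v) :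
    G.dist u v ≤ ENNReal.ofReal (G.len p) := iInf₂_le p h

theorem exists_isWalk_of_dist_lt {u v : V} {r : ℝ≥0∞} (h : G.dist u v < r) :
    ∃ p, G.IsWalk u p v ∧ ENNReal.ofReal (G.len p) < r := by
  simpa [dist, iInf_lt_iff] using h

theorem exists_isWalk_of_dist_lt_ofReal {u v : V} {r : ℝ} (h : G.dist u v < ENNReal.ofReal r) :
    ∃ p, G.IsWalk u p v ∧ G.len p < r := by
  obtain ⟨p, hp, hr⟩ := exists_isWalk_of_dist_lt h
  exact ⟨p, hp, lt_of_not_ge fun hle => hr.not_ge (ENNReal.ofReal_le_ofReal hle)⟩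

theorem dist_self (u : V) : G.dist u u = 0 := by
  simpa [len] using dist_le_len (IsWalk.nil (G := G) u)

theorem eq_of_dist_lt {a : ℝ} (ha : 0 ≤ a) (hw : ∀ e, a ≤ G.w e) {u v : V}
    (h : G.dist u v < ENNReal.ofReal a) : u = v := by
  obtain ⟨p, hp, hlt⟩ := exists_isWalk_of_dist_lt_ofReal h
  cases hp with
  | nil => rfl
  | @cons _ _ _ e p _ _ =>
    have := hw e
    have := len_nonneg (fun e => ha.trans (hw e)) p
    rw [len_cons] at hlt
    linarith

theorem eq_of_dist_eq_zero [Finite E] (hw : ∀ e, 0 < G.w e) {u v : V} (h : G.dist u v = 0) :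
    u = v := by
  rcases isEmpty_or_nonempty E with hE | hE
  · exact eq_of_dist_lt (G := G) (a := 1) zero_le_one (fun e => hE.elim e) (by simp [h])
  · obtain ⟨e, he⟩ := Finite.exists_min G.w
    exact eq_of_dist_lt (hw e).le he (by simp [h, hw e])

theorem IsWalk.sub_le_len {φ : V → ℝ} (hφ : ∀ e, |φ (G.src e) - φ (G.tgt e)| ≤ G.w e)
    {u v : V} {p : List E} (h : G.IsWalk u p v) : |φ u - φ v| ≤ G.len p := by
  induction h with
  | nil => simp [len]
  | @cons u v x e p huv _ ih =>
    rw [len_cons]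
    have : |φ u - φ v| ≤ G.w e := by
      rcases huv with ⟨rfl, rfl⟩ | ⟨rfl, rfl⟩
      · exact hφ e
      · rw [abs_sub_comm]; exact hφ e
    exact (abs_sub_le _ (φ v) _).trans (add_le_add this ih)

theorem sub_le_of_mem_ball {φ : V → ℝ} (hφ : ∀ e, |φ (G.src e) - φ (G.tgt e)| ≤ G.w e)
    {u v : V} {r : ℝ} (hr : 0 ≤ r) (h : v ∈ G.ball u r) : |φ u - φ v| ≤ r := by
  refine le_of_forall_pos_lt_add fun δ hδ => ?_
  have : G.dist u v < ENNReal.ofReal (r + δ) :=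
    lt_of_le_of_lt h ((ENNReal.ofReal_lt_ofReal_iff (by linarith)).2 (by linarith))
  obtain ⟨p, hp, hl⟩ := exists_isWalk_of_dist_lt_ofReal this
  exact (hp.sub_le_len hφ).trans_lt hl

theorem mem_ball_self (u : V) (r : ℝ) : u ∈ G.ball u r := by simp [ball, dist_self]

end Walks

/-! ### Consequences of the doubling property -/

section Doubling

variable {V E : Type*} {G : WGraph V E}

theorem IsDoubling.mono {h h' : ℝ} (hG : G.IsDoubling h) (hh : h ≤ h') : G.IsDoubling h' := by
  intro u r hr
  obtain ⟨S, hS, hc⟩ := hG u r hr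
  exact ⟨S, hS.trans (Real.rpow_le_rpow_of_exponent_le (by norm_num) hh), hc⟩

theorem exists_isDoubling [Finite V] (G : WGraph V E) : ∃ h, G.IsDoubling h := by
  cases nonempty_fintype V
  refine ⟨Fintype.card V, fun u r _ => ⟨Finset.univ, ?_, fun v _ => ?_⟩⟩
  · rw [Real.rpow_natCast, Finset.card_univ]
    exact_mod_cast (Nat.lt_two_pow_self).le
  · exact Set.mem_iUnion₂.2 ⟨v, Finset.mem_univ v, mem_ball_self v _⟩

theorem isDoubling_of_doublingDim_lt [Finite V] {h : ℝ} (hh : G.doublingDim < h) :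
    G.IsDoubling h := by
  obtain ⟨h', hG, hlt⟩ := exists_lt_of_csInf_lt G.exists_isDoubling hh
  exact IsDoubling.mono hG hlt.le

/-- Iterating the doubling property. -/
theorem IsDoubling.exists_cover {h : ℝ} (hG : G.IsDoubling h) (m : ℕ) (u : V) {r : ℝ}
    (hr : 0 < r) : ∃ S : Finset V, (S.card : ℝ) ≤ ((2 : ℝ) ^ h) ^ m ∧
      G.ball u r ⊆ ⋃ v ∈ S, G.ball v (r / 2 ^ m) := by
  classical
  induction m with
  | zero => exact ⟨{u}, by simp, by simp⟩
  | succ m ih =>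
    obtain ⟨S, hS, hc⟩ := ih
    choose T hT hTc using fun v => hG v (r / 2 ^ m) (by positivity)
    refine ⟨S.biUnion T, ?_, fun x hx => ?_⟩
    · calc ((S.biUnion T).card : ℝ) ≤ ∑ v ∈ S, ((T v).card : ℝ) := by
            exact_mod_cast Finset.card_biUnion_le
        _ ≤ ∑ v ∈ S, (2 : ℝ) ^ h := Finset.sum_le_sum fun v _ => hT v
        _ = S.card * (2 : ℝ) ^ h := by simp
        _ ≤ ((2 : ℝ) ^ h) ^ m * (2 : ℝ) ^ h := by gcongr
        _ = _ := (pow_succ _ _).symm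
    · obtain ⟨v, hv, hx⟩ := Set.mem_iUnion₂.1 (hc hx)
      obtain ⟨y, hy, hx⟩ := Set.mem_iUnion₂.1 (hTc v hx)
      refine Set.mem_iUnion₂.2 ⟨y, Finset.mem_biUnion.2 ⟨v, hv, hy⟩, ?_⟩
      rwa [pow_succ, ← div_div]

/-- A graph with an edge has doubling dimension at least one. -/
theorem IsDoubling.one_le [Finite E] [Nonempty E] (hw : ∀ e, 0 < G.w e)
    (hl : ∀ e, G.src e ≠ G.tgt e) {h : ℝ} (hG : G.IsDoubling h) : 1 ≤ h := by
  by_contra! hh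
  -- For a lightest edge, balls of half its weight are single vertices, so its two ends need two
  -- balls.
  obtain ⟨e, he⟩ := Finite.exists_min G.w
  obtain ⟨S, hS, hc⟩ := hG (G.src e) (G.w e) (hw e)
  have hlt : (S.card : ℝ) < 2 :=
    hS.trans_lt (by simpa using Real.rpow_lt_rpow_of_exponent_lt one_lt_two hh)
  have hS1 : S.card ≤ 1 := by
    have : S.card < 2 := by exact_mod_cast hlt
    omega
  obtain ⟨v, hv, h1⟩ := Set.mem_iUnion₂.1 (hc (mem_ball_self _ _))
  have hm : G.tgt e ∈ G.ball (G.src e) (G.w e) := by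
    simpa [ball, len] using dist_le_len (.cons (G.joins_src_tgt e) (.nil _))
  obtain ⟨v', hv', h2⟩ := Set.mem_iUnion₂.1 (hc hm)
  obtain rfl : v = v' := Finset.card_le_one.1 hS1 _ hv _ hv'
  have hlt' : ENNReal.ofReal (G.w e / 2) < ENNReal.ofReal (G.w e) :=
    (ENNReal.ofReal_lt_ofReal_iff (hw e)).2 (by linarith [hw e])
  exact hl e ((eq_of_dist_lt (hw e).le he (lt_of_le_of_lt h1 hlt')).symm.trans
    (eq_of_dist_lt (hw e).le he (lt_of_le_of_lt h2 hlt')))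

end Doubling

end WGraph
end

noncomputable section

namespace WGraph

/-! ### Subdivisions and the packing bound -/

section Subdivision

variable {V E : Type*} {G : WGraph V E}

theorem IsWalk.reverse {u v : V} {p : List E} (h : G.IsWalk u p v) :
    G.IsWalk v p.reverse u := by
  induction h with
  | nil => exact .nil _
  | cons h _ ih =>
    rw [List.reverse_cons]
    exact ih.append (.cons h.symm (.nil _))

theorem len_reverse (p : List E) : G.len p.reverse = G.len p := by simp [len]

theorem subdivPoint_zero (k : ℕ) (e : E) : G.subdivPoint k e 0 = Sum.inl (G.src e) := by
  simp [subdivPoint]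

theorem subdivPoint_self {k : ℕ} (hk : k ≠ 0) (e : E) :
    G.subdivPoint k e k = Sum.inl (G.tgt e) := by
  simp [subdivPoint, hk]

theorem exists_isWalk_subdivPoint (k : ℕ) (e : E) {j : ℕ} (hj : j ≤ k) :
    ∃ q, (G.subdivide k).IsWalk (Sum.inl (G.src e)) q (G.subdivPoint k e j) ∧
      (G.subdivide k).len q = j * (G.w e / k) := by
  induction j with
  | zero => exact ⟨[], by rw [subdivPoint_zero]; exact .nil _, by simp [len]⟩
  | succ j ih =>
    obtain ⟨q, hq, hl⟩ := ih (by omega)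
    refine ⟨q ++ [(e, ⟨j, hj⟩)], hq.append (.cons ?_ (.nil _)), ?_⟩
    · exact (G.subdivide k).joins_src_tgt (e, ⟨j, hj⟩)
    · rw [len_append, hl, len_cons]
      simp only [len, List.map_nil, List.sum_nil, subdivide]
      push_cast
      ring

theorem IsWalk.exists_subdivide {k : ℕ} (hk : k ≠ 0) {u v : V} {p : List E}
    (h : G.IsWalk u p v) : ∃ q, (G.subdivide k).IsWalk (Sum.inl u) q (Sum.inl v) ∧
      (G.subdivide k).len q = G.len p := by
  induction h with
  | nil => exact ⟨[], .nil _, by simp [len]⟩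
  | @cons u v x e p huv _ ih =>
    obtain ⟨q, hq, hl⟩ := ih
    obtain ⟨a, ha, hal⟩ := G.exists_isWalk_subdivPoint k e le_rfl
    rw [subdivPoint_self hk] at ha
    have hk' : (k : ℝ) ≠ 0 := by exact_mod_cast hk
    rw [mul_div_cancel₀ _ hk'] at hal
    rcases huv with ⟨rfl, rfl⟩ | ⟨rfl, rfl⟩
    · exact ⟨a ++ q, ha.append hq, by rw [len_append, hal, hl, len_cons]⟩
    · exact ⟨a.reverse ++ q, ha.reverse.append hq, by
        rw [len_append, len_reverse, hal, hl, len_cons]⟩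

theorem subdivide_src_ne_tgt {k : ℕ} (hk : 2 ≤ k) (x : E × Fin k) :
    (G.subdivide k).src x ≠ (G.subdivide k).tgt x := by
  obtain ⟨e, j, hj⟩ := x
  simp only [subdivide, subdivPoint]
  split_ifs <;> simp <;> omega

open Classical in
/-- The distance to the ends of the path that replaces `e`, extended by zero. -/
def edgePotential (G : WGraph V E) (k : ℕ) (e : E) : V ⊕ E × Fin (k - 1) → ℝ
  | Sum.inl _ => 0
  | Sum.inr (f, i) =>
    if f = e then min ((i : ℝ) + 1) (k - ((i : ℝ) + 1)) * (G.w e / k) else 0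

theorem edgePotential_subdivPoint_self {k : ℕ} (e : E) {j : ℕ} (hj : j ≤ k) :
    G.edgePotential k e (G.subdivPoint k e j) = min (j : ℝ) (k - j) * (G.w e / k) := by
  unfold subdivPoint
  split_ifs with h1 h2
  · simp [edgePotential, h1]
  · obtain ⟨i, rfl⟩ := Nat.exists_eq_succ_of_ne_zero h1
    simp [edgePotential]
  · obtain rfl : j = k := by omega
    simp [edgePotential]

theorem edgePotential_subdivPoint_of_ne {k : ℕ} {e f : E} (hf : f ≠ e) (j : ℕ) :
    G.edgePotential k e (G.subdivPoint k f j) = 0 := by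
  unfold subdivPoint
  split_ifs <;> simp [edgePotential, hf]

theorem edgePotential_lipschitz (hw : ∀ e, 0 ≤ G.w e) (k : ℕ) (e : E) (x : E × Fin k) :
    |G.edgePotential k e ((G.subdivide k).src x) - G.edgePotential k e ((G.subdivide k).tgt x)| ≤
      (G.subdivide k).w x := by
  obtain ⟨f, j, hj⟩ := x
  have hwk : 0 ≤ G.w f / k := div_nonneg (hw f) (Nat.cast_nonneg k)
  simp only [subdivide]
  by_cases hf : f = e
  · subst hf
    rw [edgePotential_subdivPoint_self f hj.le, edgePotential_subdivPoint_self f hj, ← sub_mul,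
      abs_mul, abs_of_nonneg hwk]
    refine mul_le_of_le_one_left hwk ?_
    push_cast
    rw [abs_le]
    constructor <;> rcases min_cases (j : ℝ) (k - j) with ⟨h, _⟩ | ⟨h, _⟩ <;>
      rcases min_cases ((j : ℝ) + 1) (k - (j + 1)) with ⟨h', _⟩ | ⟨h', _⟩ <;> linarith
  · rw [edgePotential_subdivPoint_of_ne hf, edgePotential_subdivPoint_of_ne hf]
    simpa using hwk

/-- Makes 2h strictly larger than h, so that fine subdivisions are doubling with exponent 2h. -/
theorem HasCDD.one_le [Finite V] [Finite E] [Nonempty E] (hw : ∀ e, 0 < G.w e)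
    {h : ℝ} (hG : G.HasCDD h) : 1 ≤ h := by
  refine ge_of_tendsto hG ?_
  filter_upwards [eventually_ge_atTop 2] with k hk
  have : Nonempty (Fin k) := ⟨⟨0, by omega⟩⟩
  exact le_csInf (G.subdivide k).exists_isDoubling fun h' hh' => hh'.one_le
    (fun x => div_pos (hw x.1) (by exact_mod_cast (by omega : 0 < k))) (subdivide_src_ne_tgt hk)

/-- A packing bound: there are few edges of weight more than `τ` that start in a given ball. -/
theorem HasCDD.ncard_le [Finite V] [Finite E] [Nonempty E] (hw : ∀ e, 0 < G.w e) {h : ℝ}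
    (hG : G.HasCDD h) (s : V) {r τ : ℝ} (hr : 0 ≤ r) (hτ : 0 < τ) {A : Set E}
    (hA : ∀ e ∈ A, G.src e ∈ G.ball s r ∧ τ < G.w e) {m : ℕ} (hm : 8 * (r + τ) < τ * 2 ^ m) :
    (A.ncard : ℝ) ≤ ((2 : ℝ) ^ (2 * h)) ^ m := by
  classical
  have h1 := hG.one_le hw
  -- Subdivision steps of length at most τ/4 guarantee a point between τ/4 and τ/2 along each long
  -- edge.
  have hev : ∀ᶠ k : ℕ in atTop, ∀ e, 4 * G.w e / τ ≤ k :=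
    eventually_all.2 fun e => tendsto_natCast_atTop_atTop.eventually_ge_atTop _
  obtain ⟨k, hk, hk2, hdim⟩ := (hev.and ((eventually_ge_atTop 2).and
    (hG.eventually_lt_const (by linarith : h < 2 * h)))).exists
  have hk0 : (0 : ℝ) < k := by exact_mod_cast (by omega : 0 < k)
  have hsmall : ∀ e, G.w e / k ≤ τ / 4 := by
    intro e
    have := hk e
    rw [div_le_iff₀ hτ] at this
    rw [div_le_iff₀ hk0]
    linarith
  have hpt : ∀ e ∈ A, ∃ x, x ∈ (G.subdivide k).ball (Sum.inl s) (r + τ) ∧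
      τ / 4 ≤ G.edgePotential k e x ∧ ∀ f, f ≠ e → G.edgePotential k f x = 0 := by
    intro e he
    obtain ⟨hes, hew⟩ := hA e he
    have hu : 0 < G.w e / k := div_pos (hw e) hk0
    have hku : k * (G.w e / k) = G.w e := mul_div_cancel₀ _ hk0.ne'
    set j := ⌈τ / 4 / (G.w e / k)⌉₊ with hj
    have hj1 : τ / 4 ≤ j * (G.w e / k) := (div_le_iff₀ hu).1 (Nat.le_ceil _)
    have hj2 : j * (G.w e / k) ≤ τ / 2 := by
      have := (Nat.ceil_lt_add_one (by positivity : 0 ≤ τ / 4 / (G.w e / k))).le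
      have := mul_le_mul_of_nonneg_right this hu.le
      rw [← hj, add_mul, div_mul_cancel₀ _ hu.ne', one_mul] at this
      linarith [hsmall e]
    have hj3 : τ / 4 ≤ (k - j) * (G.w e / k) := by
      rw [sub_mul, hku]
      linarith
    have hjk : j ≤ k := by
      by_contra! hlt
      have : (k : ℝ) < j := by exact_mod_cast hlt
      nlinarith
    refine ⟨G.subdivPoint k e j, ?_, ?_, fun f hf => edgePotential_subdivPoint_of_ne hf.symm j⟩
    · have hlt : G.dist s (G.src e) < ENNReal.ofReal (r + τ / 2) :=
        lt_of_le_of_lt hes ((ENNReal.ofReal_lt_ofReal_iff (by linarith)).2 (by linarith))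
      obtain ⟨p, hp, hpl⟩ := exists_isWalk_of_dist_lt_ofReal hlt
      obtain ⟨q, hq, hql⟩ := hp.exists_subdivide (k := k) (by omega)
      obtain ⟨q', hq', hql'⟩ := G.exists_isWalk_subdivPoint k e hjk
      refine (dist_le_len (hq.append hq')).trans (ENNReal.ofReal_le_ofReal ?_)
      rw [len_append, hql, hql']
      linarith
    · rw [edgePotential_subdivPoint_self e hjk, min_mul_of_nonneg _ _ hu.le]
      exact le_min hj1 hj3
  have hrad : 0 ≤ (r + τ) / 2 ^ m := by positivity
  -- The potential varies by less than τ/4 within one small ball, so the marked points of two edges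
  -- cannot share one.
  have hrad' : 2 * ((r + τ) / 2 ^ m) < τ / 4 := by
    rw [← mul_div_assoc, div_lt_iff₀ (by positivity)]
    linarith
  obtain ⟨S, hS, hcov⟩ := (isDoubling_of_doublingDim_lt hdim).exists_cover m (Sum.inl s)
    (by linarith : 0 < r + τ)
  have hcen : ∀ e ∈ A, ∃ v ∈ S, (∃ x, x ∈ (G.subdivide k).ball v ((r + τ) / 2 ^ m) ∧
      τ / 4 ≤ G.edgePotential k e x ∧ ∀ f, f ≠ e → G.edgePotential k f x = 0) := by
    intro e he
    obtain ⟨x, hx, hx'⟩ := hpt e he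
    obtain ⟨v, hv, hxv⟩ := Set.mem_iUnion₂.1 (hcov hx)
    exact ⟨v, hv, x, hxv, hx'⟩
  have : Nonempty (V ⊕ E × Fin (k - 1)) := ⟨Sum.inl s⟩
  choose! cen hcenS hcen using hcen
  have hinj : Set.InjOn cen A := by
    intro e he f hf hef
    by_contra hne
    obtain ⟨x, hx, hxe, -⟩ := hcen e he
    obtain ⟨y, hy, -, hy0⟩ := hcen f hf
    have h2 := sub_le_of_mem_ball (edgePotential_lipschitz (fun e => (hw e).le) k e) hrad hx
    have h3 := sub_le_of_mem_ball (edgePotential_lipschitz (fun e => (hw e).le) k e) hrad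
      (hef ▸ hy)
    rw [hy0 e hne] at h3
    have h4 := (abs_le.1 h2).1
    have h5 := (abs_le.1 h3).2
    linarith
  have hcard : A.ncard ≤ S.card := by
    rw [← Set.ncard_coe_finset]
    exact Set.ncard_le_ncard_of_injOn cen hcenS hinj
  calc (A.ncard : ℝ) ≤ S.card := by exact_mod_cast hcard
    _ ≤ _ := hS

end Subdivision

/-! ### Counting the probed edges -/

section Probes

variable {V E : Type*} [Fintype V] {G : WGraph V E} {s t : V} {ρ ε c : ℝ}

omit [Fintype V] in
theorem edgesIn_ball_zero [Finite E] (hl : ∀ e, G.src e ≠ G.tgt e) (hw : ∀ e, 0 < G.w e) (s : V) :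
    G.edgesIn (G.ball s 0) = ∅ := by
  have key : ∀ v ∈ G.ball s 0, s = v := fun v hv =>
    eq_of_dist_eq_zero hw (by simpa [ball] using hv)
  refine Set.eq_empty_of_forall_notMem fun e he => hl e ?_
  rw [← key _ he.1, ← key _ he.2]

theorem one_lt_log_three : 1 < Real.log 3 := by
  rw [Real.lt_log_iff_exp_lt (by norm_num)]
  linarith [Real.exp_one_lt_d9]

theorem ncard_probedEdges_le [Finite E] (hl : ∀ e, G.src e ≠ G.tgt e) (hw : ∀ e, 0 < G.w e)
    (hρ : 1 ≤ ρ) (hε : 0 < ε) (hε' : ε ≤ 1) (hc : 0 < c) (hc' : c ≤ 1) {h : ℝ}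
    (hG : G.HasCDD h) (hV : 3 ≤ Fintype.card V) :
    ((G.probedEdges s t ρ ε c).ncard : ℝ) ≤
      (ρ * Real.log (Fintype.card V) / ε) ^
        (2 * (8 + Real.log (32 / c) / Real.log (Real.log 3)) * h) := by
  have hlog : Real.log 3 ≤ Real.log (Fintype.card V) :=
    Real.log_le_log (by norm_num) (by exact_mod_cast hV)
  have hb := one_lt_log_three
  set N := Real.log (Fintype.card V) with hN
  set L := (G.dist s t).toReal with hLdef
  have hN1 : 1 ≤ N := by linarith
  have hN0 : 0 < N := by linarith
  have hB : Real.log 3 ≤ ρ * N / ε := by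
    rw [le_div_iff₀ hε]
    nlinarith
  have hB0 : 0 < ρ * N / ε := by linarith
  have hL0 : 0 ≤ L := ENNReal.toReal_nonneg
  -- When L = 0 the threshold vanishes and packing is unavailable, but the absence of loops leaves
  -- the region without edges.
  rcases hL0.eq_or_lt with hL | hL
  · have : G.probedEdges s t ρ ε c = ∅ := by
      refine Set.eq_empty_of_forall_notMem fun e he => ?_
      have he' := he.1
      rw [region, ← hLdef, ← hL, mul_zero, edgesIn_ball_zero hl hw] at he'
      exact he'
    rw [this, Set.ncard_empty, Nat.cast_zero]
    exact Real.rpow_nonneg hB0.le _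
  rcases isEmpty_or_nonempty E with hE | hE
  · rw [Set.eq_empty_of_isEmpty (G.probedEdges s t ρ ε c), Set.ncard_empty, Nat.cast_zero]
    exact Real.rpow_nonneg hB0.le _
  have h1 := hG.one_le hw
  set τ := G.threshold s t ρ ε c with hτ
  have hτe : τ = c * ε ^ 2 * L / (ρ ^ 4 * N) := rfl
  have hρ0 : 0 < ρ := by linarith
  have hτ0 : 0 < τ := by rw [hτe]; positivity
  have hτL : τ ≤ ρ * L := by
    rw [hτe, div_le_iff₀ (by positivity)]
    have h2 : c * ε ^ 2 ≤ 1 := mul_le_one₀ hc' (by positivity) (pow_le_one₀ hε.le hε')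
    have h3 : 1 ≤ ρ * (ρ ^ 4 * N) :=
      one_le_mul_of_one_le_of_one_le hρ (one_le_mul_of_one_le_of_one_le (one_le_pow₀ hρ) hN1)
    nlinarith
  -- Since τ ≤ ρL, the packing condition with r = ρL follows from X < 2 ^ (m + 1).
  set X := 16 * (ρ * L) / τ with hX
  have hX1 : 1 ≤ X := by
    rw [hX, le_div_iff₀ hτ0]
    nlinarith
  obtain ⟨m, hm1, hm2⟩ := exists_nat_pow_near hX1 one_lt_two
  have hcard := hG.ncard_le hw s (r := ρ * L) (by positivity) hτ0
    (A := G.probedEdges s t ρ ε c) (fun e he => ⟨he.1.1, he.2⟩) (m := m + 1) (by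
      rw [hX, div_lt_iff₀ hτ0] at hm2
      linarith)
  have hX2 : 2 * X = 32 / c * (ρ ^ 5 * N / ε ^ 2) := by
    rw [hX, hτe]
    field_simp
    ring
  have hc32 : 1 ≤ 32 / c := by
    rw [le_div_iff₀ hc]
    linarith
  have hlb : 0 < Real.log (Real.log 3) := Real.log_pos hb
  have hX3 : 2 * X ≤ (ρ * N / ε) ^ (8 + Real.log (32 / c) / Real.log (Real.log 3)) := by
    rw [hX2, Real.rpow_add hB0, mul_comm]
    -- The base is at least log 3 > 1, by n ≥ 3, so a constant factor is absorbed into the exponent.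
    have e1 : 32 / c ≤ (ρ * N / ε) ^ (Real.log (32 / c) / Real.log (Real.log 3)) := by
      calc 32 / c = (Real.log 3) ^ (Real.log (32 / c) / Real.log (Real.log 3)) := by
            rw [Real.rpow_def_of_pos (by linarith), mul_div_cancel₀ _ hlb.ne',
              Real.exp_log (by positivity)]
        _ ≤ _ := Real.rpow_le_rpow (by linarith) hB
            (div_nonneg (Real.log_nonneg hc32) hlb.le)
    have e2 : ρ ^ 5 * N / ε ^ 2 ≤ (ρ * N / ε) ^ (8 : ℝ) := by
      have e3 : (ρ * N / ε) ^ (8 : ℝ) = (ρ * N / ε) ^ 8 := by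
        rw [← Real.rpow_natCast]
        norm_num
      have e4 : (ρ * N / ε) ^ 8 = ρ ^ 5 * N / ε ^ 2 * (ρ ^ 3 * N ^ 7 / ε ^ 6) := by
        field_simp
      rw [e3, e4]
      refine le_mul_of_one_le_right (by positivity) ?_
      rw [one_le_div (by positivity)]
      exact (pow_le_one₀ hε.le hε').trans
        (one_le_mul_of_one_le_of_one_le (one_le_pow₀ hρ) (one_le_pow₀ hN1))
    gcongr
  calc ((G.probedEdges s t ρ ε c).ncard : ℝ) ≤ ((2 : ℝ) ^ (2 * h)) ^ (m + 1) := hcard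
    _ = ((2 : ℝ) ^ (m + 1)) ^ (2 * h) := by
        rw [← Real.rpow_natCast, ← Real.rpow_mul (by norm_num), mul_comm,
          Real.rpow_mul (by norm_num), Real.rpow_natCast]
    _ ≤ (2 * X) ^ (2 * h) := by
        refine Real.rpow_le_rpow (by positivity) ?_ (by linarith)
        rw [pow_succ]
        linarith
    _ ≤ ((ρ * N / ε) ^ (8 + Real.log (32 / c) / Real.log (Real.log 3))) ^ (2 * h) :=
        Real.rpow_le_rpow (by linarith) hX3 (by linarith)
    _ = _ := by
        rw [← Real.rpow_mul hB0.le]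
        congr 1
        ring

end Probes

end WGraph
end

noncomputable section

namespace WGraph

/-! ### The distance as a minimum of linear functions of the weights -/

section MinLen

variable {V E : Type*} [Fintype E] {G : WGraph V E} {s t : V}

open Classical in
/-- The edge sets of the walks from `s` to `t` that use no edge twice. -/
def edgeSets (G : WGraph V E) (s t : V) : Finset (Finset E) :=
  {F | ∃ p, G.IsWalk s p t ∧ p.Nodup ∧ p.toFinset = F}

/-- The least weight of an edge set of a walk, as a function of the edge weights. -/
def minLen (h : (G.edgeSets s t).Nonempty) (x : E → ℝ) : ℝ :=
  (G.edgeSets s t).inf' h fun F => ∑ e ∈ F, x e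

theorem minLen_le (h : (G.edgeSets s t).Nonempty) (x : E → ℝ) {F : Finset E}
    (hF : F ∈ G.edgeSets s t) : minLen h x ≤ ∑ e ∈ F, x e :=
  Finset.inf'_le (fun F => ∑ e ∈ F, x e) hF

theorem exists_minLen_eq (h : (G.edgeSets s t).Nonempty) (x : E → ℝ) :
    ∃ F ∈ G.edgeSets s t, minLen h x = ∑ e ∈ F, x e :=
  Finset.exists_mem_eq_inf' h _

theorem minLen_nonneg (h : (G.edgeSets s t).Nonempty) {x : E → ℝ} (hx : ∀ e, 0 ≤ x e) :
    0 ≤ minLen h x := by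
  obtain ⟨F, -, hF⟩ := exists_minLen_eq h x
  exact hF ▸ Finset.sum_nonneg fun e _ => hx e

theorem minLen_mono (h : (G.edgeSets s t).Nonempty) {x y : E → ℝ} (hxy : ∀ e, x e ≤ y e) :
    minLen h x ≤ minLen h y := by
  obtain ⟨F, hF, hy⟩ := exists_minLen_eq h y
  exact (minLen_le h x hF).trans (hy ▸ Finset.sum_le_sum fun e _ => hxy e)

theorem minLen_le_mul (h : (G.edgeSets s t).Nonempty) {x y : E → ℝ} {ρ : ℝ}
    (hxy : ∀ e, x e ≤ ρ * y e) : minLen h x ≤ ρ * minLen h y := by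
  obtain ⟨F, hF, hy⟩ := exists_minLen_eq h y
  refine (minLen_le h x hF).trans ?_
  rw [hy, Finset.mul_sum]
  exact Finset.sum_le_sum fun e _ => hxy e

/-- One edge set serves all nonnegative weights at once, which reduces the infimum over walks to a
fixed finite minimum. -/
theorem IsWalk.exists_mem_edgeSets {p : List E} (hp : G.IsWalk s p t) :
    ∃ F ∈ G.edgeSets s t, ∀ x : E → ℝ, (∀ e, 0 ≤ x e) →
      ∑ e ∈ F, x e ≤ (G.reweight x).len p := by
  classical
  obtain ⟨q, hq, hn, hs⟩ := hp.exists_nodup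
  refine ⟨q.toFinset, by simpa [edgeSets] using ⟨q, hq, hn, by congr⟩, fun x hx => ?_⟩
  rw [List.sum_toFinset x hn]
  refine List.Sublist.sum_le_sum (hs.map x) fun a ha => ?_
  obtain ⟨e, -, rfl⟩ := List.mem_map.1 ha
  exact hx e

theorem exists_isWalk_of_mem_edgeSets {F : Finset E} (hF : F ∈ G.edgeSets s t) :
    ∃ p, G.IsWalk s p t ∧ (∀ e, e ∈ p ↔ e ∈ F) ∧ p.Nodup ∧
      ∀ x : E → ℝ, (G.reweight x).len p = ∑ e ∈ F, x e := by
  classical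
  obtain ⟨p, hp, hn, hF⟩ := (Finset.mem_filter.1 hF).2
  refine ⟨p, hp, fun e => by rw [← hF, List.mem_toFinset], hn, fun x => ?_⟩
  rw [← hF, List.sum_toFinset x hn]
  rfl

theorem edgeSets_nonempty (h : G.dist s t ≠ ⊤) : (G.edgeSets s t).Nonempty := by
  obtain ⟨p, hp, -⟩ := exists_isWalk_of_dist_lt h.lt_top
  obtain ⟨F, hF, -⟩ := hp.exists_mem_edgeSets
  exact ⟨F, hF⟩

theorem dist_reweight_eq (h : (G.edgeSets s t).Nonempty) {x : E → ℝ} (hx : ∀ e, 0 ≤ x e) :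
    (G.reweight x).dist s t = ENNReal.ofReal (minLen h x) := by
  refine le_antisymm ?_ (le_iInf₂ fun p hp => ENNReal.ofReal_le_ofReal ?_)
  · obtain ⟨F, hF, hm⟩ := exists_minLen_eq h x
    obtain ⟨p, hp, -, -, hl⟩ := exists_isWalk_of_mem_edgeSets hF
    rw [hm, ← hl]
    exact dist_le_len (hp.reweight x)
  · obtain ⟨F, hF, hl⟩ := hp.of_reweight.exists_mem_edgeSets
    exact (minLen_le h x hF).trans (hl x hx)

theorem toReal_dist_eq (h : (G.edgeSets s t).Nonempty) (hw : ∀ e, 0 ≤ G.w e) :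
    (G.dist s t).toReal = minLen h G.w := by
  have : G.dist s t = (G.reweight G.w).dist s t := rfl
  rw [this, dist_reweight_eq h hw, ENNReal.toReal_ofReal (minLen_nonneg h hw)]

open Classical in
theorem concaveOn_minLen_piecewise (h : (G.edgeSets s t).Nonempty) (P : Set E) (x : E → ℝ) :
    ConcaveOn ℝ Set.univ fun y => minLen h (P.piecewise x y) := by
  refine ⟨convex_univ, fun y _ z _ a b ha hb hab => ?_⟩
  obtain ⟨F, hF, hm⟩ := exists_minLen_eq h (P.piecewise x (a • y + b • z))
  have hlin : ∀ e, P.piecewise x (a • y + b • z) e =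
      a * P.piecewise x y e + b * P.piecewise x z e := by
    intro e
    by_cases he : e ∈ P
    · simp [he, ← add_mul, hab]
    · simp [he]
  simp only [smul_eq_mul]
  rw [hm, Finset.sum_congr rfl fun e _ => hlin e, Finset.sum_add_distrib, ← Finset.mul_sum,
    ← Finset.mul_sum]
  gcongr <;> exact minLen_le h _ hF

/-- If the weights are changed on the edges outside of `P`, then the minimal length increases by no
more than the change on an edge set of a walk which is minimal for the old weights. -/
theorem mul_minLen_sub_le (h : (G.edgeSets s t).Nonempty) {P : Set E} [DecidablePred (· ∈ P)]
    {x y z : E → ℝ}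
    {F : Finset E} (hF : F ∈ G.edgeSets s t)
    (hm : minLen h (P.piecewise z x) = ∑ e ∈ F, P.piecewise z x e) {l : E → ℝ}
    (hl : ∀ e, 0 < l e) (lam : ℝ) (hlam : 0 ≤ lam) {S : ℝ}
    (hS : ∑ e ∈ F with e ∉ P, l e ^ 2 ≤ S) :
    lam * (minLen h (P.piecewise z y) - minLen h (P.piecewise z x)) ≤
      4 * lam ^ 2 * S + ∑ e, ((x - y) e / l e) ^ 2 / 16 := by
  have h1 : minLen h (P.piecewise z y) - minLen h (P.piecewise z x) ≤
      ∑ e ∈ F with e ∉ P, (y e - x e) := by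
    rw [Finset.sum_filter]
    refine (sub_le_sub_right (minLen_le h _ hF) _).trans_eq ?_
    rw [hm, ← Finset.sum_sub_distrib]
    refine Finset.sum_congr rfl fun e _ => ?_
    by_cases he : e ∈ P <;> simp [he]
  -- AM-GM with weights matched to the factor 1/16 of the transport cost.
  have h2 : ∀ e, lam * (y e - x e) ≤ 4 * lam ^ 2 * l e ^ 2 + ((x - y) e / l e) ^ 2 / 16 := by
    intro e
    have h3 : y e - x e = -(((x - y) e / l e) * l e) := by
      rw [div_mul_cancel₀ _ (hl e).ne']
      simp
    rw [h3]
    nlinarith [sq_nonneg (2 * lam * l e + ((x - y) e / l e) / 4)]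
  calc lam * (minLen h (P.piecewise z y) - minLen h (P.piecewise z x))
      ≤ lam * ∑ e ∈ F with e ∉ P, (y e - x e) := by gcongr
    _ = ∑ e ∈ F with e ∉ P, lam * (y e - x e) := Finset.mul_sum _ _ _
    _ ≤ ∑ e ∈ F with e ∉ P, (4 * lam ^ 2 * l e ^ 2 + ((x - y) e / l e) ^ 2 / 16) :=
        Finset.sum_le_sum fun e _ => h2 e
    _ = 4 * lam ^ 2 * ∑ e ∈ F with e ∉ P, l e ^ 2 +
          ∑ e ∈ F with e ∉ P, ((x - y) e / l e) ^ 2 / 16 := by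
        rw [Finset.sum_add_distrib, Finset.mul_sum]
    _ ≤ _ := by
        gcongr
        exact Finset.subset_univ _

end MinLen

/-! ### Minimal walks stay in the region -/

section Region

variable {V E : Type*} [Fintype E] {G : WGraph V E} {s t : V} {ρ : ℝ}

omit [Fintype E] in
theorem mem_edgesIn_ball {u v : V} {p : List E} (hw : ∀ e, 0 ≤ G.w e) (hp : G.IsWalk u p v)
    {r : ℝ} (hr : G.len p ≤ r) {e : E} (he : e ∈ p) : e ∈ G.edgesIn (G.ball u r) := by
  obtain ⟨a, b, rfl⟩ := List.append_of_mem he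
  obtain ⟨y, ha, hb⟩ := hp.exists_of_append
  obtain ⟨z, hz, -⟩ := isWalk_cons_iff.1 hb
  rw [len_append, len_cons] at hr
  have h0 := len_nonneg hw b
  have hy : y ∈ G.ball u r :=
    (dist_le_len ha).trans (ENNReal.ofReal_le_ofReal (by linarith [hw e]))
  have hz' : z ∈ G.ball u r := by
    refine (dist_le_len (ha.append (.cons hz (.nil _)))).trans (ENNReal.ofReal_le_ofReal ?_)
    rw [len_append, len_cons]
    simp only [len, List.map_nil, List.sum_nil] at h0 ⊢
    simp only [len] at hr
    linarith
  rcases hz with ⟨rfl, rfl⟩ | ⟨rfl, rfl⟩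
  · exact ⟨hy, hz'⟩
  · exact ⟨hz', hy⟩

theorem sum_w_le (h : (G.edgeSets s t).Nonempty) (hw : ∀ e, 0 ≤ G.w e) {x : E → ℝ}
    (hx : ∀ e, x e ∈ Set.Icc (G.w e) (ρ * G.w e)) {F : Finset E}
    (hm : minLen h x = ∑ e ∈ F, x e) : ∑ e ∈ F, G.w e ≤ ρ * (G.dist s t).toReal := by
  calc ∑ e ∈ F, G.w e ≤ ∑ e ∈ F, x e := Finset.sum_le_sum fun e _ => (hx e).1
    _ = minLen h x := hm.symm
    _ ≤ _ := by
      rw [toReal_dist_eq h hw]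
      exact minLen_le_mul h fun e => (hx e).2

theorem mem_edgesIn_region (h : (G.edgeSets s t).Nonempty) (hw : ∀ e, 0 ≤ G.w e) {x : E → ℝ}
    (hx : ∀ e, x e ∈ Set.Icc (G.w e) (ρ * G.w e)) {F : Finset E} (hF : F ∈ G.edgeSets s t)
    (hm : minLen h x = ∑ e ∈ F, x e) {e : E} (he : e ∈ F) :
    e ∈ G.edgesIn (G.region s t ρ) := by
  obtain ⟨p, hp, hpF, -, hl⟩ := exists_isWalk_of_mem_edgeSets hF
  exact mem_edgesIn_ball hw hp ((hl G.w).trans_le (sum_w_le h hw hx hm)) ((hpF e).2 he)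

omit [Fintype E] in
theorem IsWalk.exists_induce {S : Set V} {u v : V} {p : List E} (hp : G.IsWalk u p v)
    (hS : ∀ e ∈ p, e ∈ G.edgesIn S) :
    ∃ q : List (G.edgesIn S), q.map Subtype.val = p ∧ (G.induce S).IsWalk u q v := by
  induction hp with
  | nil => exact ⟨[], rfl, .nil _⟩
  | @cons u v x e p h _ ih =>
    obtain ⟨q, rfl, hq⟩ := ih fun e' he' => hS e' (List.mem_cons_of_mem _ he')
    exact ⟨⟨e, hS e List.mem_cons_self⟩ :: q, rfl, .cons h hq⟩

omit [Fintype E] in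
theorem IsWalk.map_val {S : Set V} {u v : V} {q : List (G.edgesIn S)}
    (hq : (G.induce S).IsWalk u q v) : G.IsWalk u (q.map Subtype.val) v := by
  induction hq with
  | nil => exact .nil _
  | cons h _ ih => exact .cons h ih

-- Restricting to the region loses nothing: a walk that is minimal for weights between w and ρw has
-- length at most ρL in G, so it never leaves the ball.
open Classical in
theorem approximateLength_eq [Fintype V] (h : (G.edgeSets s t).Nonempty) (hw : ∀ e, 0 ≤ G.w e)
    (ε c : ℝ) {x y : E → ℝ} (hx : ∀ e, x e ∈ Set.Icc (G.w e) (ρ * G.w e))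
    (hy : ∀ e, y e ∈ Set.Icc (G.w e) (ρ * G.w e)) :
    G.approximateLength s t ρ ε c x y =
      ENNReal.ofReal (minLen h ((G.probedEdges s t ρ ε c).piecewise x y)) := by
  set z := (G.probedEdges s t ρ ε c).piecewise x y with hz
  have hz' : ∀ e, z e ∈ Set.Icc (G.w e) (ρ * G.w e) := by
    intro e
    by_cases he : e ∈ G.probedEdges s t ρ ε c
    · simpa [hz, he] using hx e
    · simpa [hz, he] using hy e
  have hlen : ∀ q : List (G.edgesIn (G.region s t ρ)),
      (G.simulation s t ρ ε c x y).len q = (G.reweight z).len (q.map Subtype.val) := by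
    intro q
    simp only [len, List.map_map]
    rfl
  refine le_antisymm ?_ (le_iInf₂ fun q hq => ENNReal.ofReal_le_ofReal ?_)
  · obtain ⟨F, hF, hm⟩ := exists_minLen_eq h z
    obtain ⟨p, hp, hpF, -, hl⟩ := exists_isWalk_of_mem_edgeSets hF
    obtain ⟨q, rfl, hq⟩ := hp.exists_induce fun e he =>
      mem_edgesIn_region h hw hz' hF hm ((hpF e).1 he)
    rw [hm, ← hl, ← hlen]
    exact dist_le_len (hq.reweight _)
  · have hq' : G.IsWalk s (q.map Subtype.val) t := (IsWalk.map_val hq.of_reweight).of_reweight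
    obtain ⟨F, hF, hl⟩ := hq'.exists_mem_edgeSets
    rw [hlen]
    exact (minLen_le h z hF).trans (hl z fun e => (hw e).trans (hz' e).1)

/-- This estimate dictates the threshold τ: the sum is at most ρ²τ times the weight of F in G, hence
at most ρ³τL, which leaves a factor ρ to spare. -/
theorem sum_sq_le [Fintype V] (h : (G.edgeSets s t).Nonempty) (hw : ∀ e, 0 ≤ G.w e) {ε c : ℝ}
    (hρ : 1 ≤ ρ) (hc : 0 ≤ c) (hn : 0 < Real.log (Fintype.card V)) {x : E → ℝ}
    (hx : ∀ e, x e ∈ Set.Icc (G.w e) (ρ * G.w e)) {F : Finset E} (hF : F ∈ G.edgeSets s t)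
    (hm : minLen h x = ∑ e ∈ F, x e) [DecidablePred (· ∈ G.probedEdges s t ρ ε c)] :
    ∑ e ∈ F with e ∉ G.probedEdges s t ρ ε c, (ρ * G.w e) ^ 2 ≤
      c * ε ^ 2 * (G.dist s t).toReal ^ 2 / Real.log (Fintype.card V) := by
  set L := (G.dist s t).toReal with hL
  have hL0 : 0 ≤ L := ENNReal.toReal_nonneg
  set N := Real.log (Fintype.card V) with hN
  have hτ0 : 0 ≤ G.threshold s t ρ ε c := by
    unfold threshold
    positivity
  calc ∑ e ∈ F with e ∉ G.probedEdges s t ρ ε c, (ρ * G.w e) ^ 2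
      ≤ ∑ e ∈ F with e ∉ G.probedEdges s t ρ ε c, ρ ^ 2 * G.threshold s t ρ ε c * G.w e := by
        refine Finset.sum_le_sum fun e he => ?_
        obtain ⟨he, he'⟩ := Finset.mem_filter.1 he
        have hle : G.w e ≤ G.threshold s t ρ ε c :=
          not_lt.1 fun hlt => he' ⟨mem_edgesIn_region h hw hx hF hm he, hlt⟩
        have := hw e
        calc (ρ * G.w e) ^ 2 = ρ ^ 2 * G.w e * G.w e := by ring
          _ ≤ _ := by gcongr
    _ ≤ ∑ e ∈ F, ρ ^ 2 * G.threshold s t ρ ε c * G.w e :=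
        Finset.sum_le_sum_of_subset_of_nonneg (Finset.filter_subset _ _) fun e _ _ => by
          have := hw e
          positivity
    _ = ρ ^ 2 * G.threshold s t ρ ε c * ∑ e ∈ F, G.w e := (Finset.mul_sum _ _ _).symm
    _ ≤ ρ ^ 2 * G.threshold s t ρ ε c * (ρ * L) := by
        gcongr
        exact sum_w_le h hw hx hm
    _ = c * ε ^ 2 * L ^ 2 / N * (1 / ρ) := by
        have : ρ ≠ 0 := by positivity
        rw [threshold, ← hL, ← hN]
        field_simp
    _ ≤ c * ε ^ 2 * L ^ 2 / N * 1 := by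
        gcongr
        rw [div_le_one (by positivity)]
        exact hρ
    _ = _ := mul_one _

end Region

/-! ### Resampling and concentration of the minimal length -/

section Concentration

open Classical in
theorem measurePreserving_piecewise {ι : Type*} [Fintype ι] (D : ι → Measure ℝ)
    [∀ i, IsProbabilityMeasure (D i)] (P : Set ι) :
    MeasurePreserving (fun p : (ι → ℝ) × (ι → ℝ) => P.piecewise p.1 p.2)
      ((Measure.pi D).prod (Measure.pi D)) (Measure.pi D) := by
  have hmeas : Measurable fun p : (ι → ℝ) × (ι → ℝ) => P.piecewise p.1 p.2 := by
    refine measurable_pi_iff.2 fun i => ?_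
    by_cases hi : i ∈ P <;> simp only [hi, Set.piecewise_eq_of_mem, Set.piecewise_eq_of_notMem,
      not_false_eq_true] <;> fun_prop
  refine ⟨hmeas, (Measure.pi_eq fun S hS => ?_).symm⟩
  rw [Measure.map_apply hmeas (MeasurableSet.univ_pi hS)]
  have : (fun p : (ι → ℝ) × (ι → ℝ) => P.piecewise p.1 p.2) ⁻¹' Set.univ.pi S =
      (Set.univ.pi fun i => if i ∈ P then S i else Set.univ) ×ˢ
        (Set.univ.pi fun i => if i ∈ P then Set.univ else S i) := by
    ext p
    simp only [Set.mem_preimage, Set.mem_pi, Set.mem_univ, true_imp_iff, Set.mem_prod,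
      ← forall_and]
    refine forall_congr' fun i => ?_
    by_cases hi : i ∈ P <;> simp [hi]
  rw [this, Measure.prod_prod, Measure.pi_pi, Measure.pi_pi, ← Finset.prod_mul_distrib]
  refine Finset.prod_congr rfl fun i _ => ?_
  by_cases hi : i ∈ P <;> simp [hi]

variable {V E : Type*} [Fintype V] [Fintype E] {G : WGraph V E} {s t : V} {ρ ε c : ℝ}

open Classical in
/-- The minimal length changes little when the weights of the edges which are not probed are
resampled, for fixed weights `z` of the probed edges. -/
theorem measure_minLen_sub_le (h : (G.edgeSets s t).Nonempty) (hw : ∀ e, 0 < G.w e)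
    (hρ : 1 ≤ ρ) (hε : 0 < ε) (hc : 0 < c) (hn : 0 < Real.log (Fintype.card V))
    (hL : 0 < (G.dist s t).toReal) {D : E → Measure ℝ} [∀ e, IsProbabilityMeasure (D e)]
    (hD : ∀ e, ∀ᵐ x ∂(D e), x ∈ Set.Icc (G.w e) (ρ * G.w e)) {z : E → ℝ}
    (hz : ∀ e, z e ∈ Set.Icc (G.w e) (ρ * G.w e)) :
    ((Measure.pi D).prod (Measure.pi D)) {p | ε * (G.dist s t).toReal <
        |minLen h ((G.probedEdges s t ρ ε c).piecewise z p.1) -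
          minLen h ((G.probedEdges s t ρ ε c).piecewise z p.2)|} ≤
      2 * ENNReal.ofReal ((Fintype.card V : ℝ) ^ (-(1 / (16 * c)))) := by
  set L := (G.dist s t).toReal
  set N := Real.log (Fintype.card V) with hN
  set P := G.probedEdges s t ρ ε c
  -- This value minimizes σ - lam * ε * L; the minimum is -N / (16c).
  set lam := N / (8 * c * ε * L) with hlam
  have hlam0 : 0 < lam := by positivity
  set σ := 4 * lam ^ 2 * (c * ε ^ 2 * L ^ 2 / N) with hσ
  let φ : (E → ℝ) → ℝ := fun y => -(lam * minLen h (P.piecewise z y))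
  have hφ : ConvexOn ℝ Set.univ φ :=
    ((concaveOn_minLen_piecewise h P z).smul hlam0.le).neg
  have hl : ∀ e, 0 < ρ * G.w e := fun e => mul_pos (by positivity) (hw e)
  have hM := maureyProperty_pi D (a := G.w) (b := fun e => ρ * G.w e) (l := fun e => ρ * G.w e)
    (fun e => le_mul_of_one_le_left (hw e).le hρ) hl (fun e => by linarith [hw e]) hD
  have hle := hM.measure_le (isCompact_univ_pi fun e => isCompact_Icc) (ae_mem_univ_pi hD) hφ
    (σ := σ) (fun x hx y hy => ?_) (lam * (ε * L))
  · have hexp : Real.exp (σ - lam * (ε * L)) = (Fintype.card V : ℝ) ^ (-(1 / (16 * c))) := by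
      have hV : (0 : ℝ) < Fintype.card V := by
        by_contra h0
        have : (Fintype.card V : ℝ) = 0 := le_antisymm (not_lt.1 h0) (Nat.cast_nonneg _)
        rw [hN, this, Real.log_zero] at hn
        exact lt_irrefl _ hn
      rw [Real.rpow_def_of_pos hV, ← hN, hσ, hlam]
      congr 1
      field_simp
      ring
    rw [hexp] at hle
    have hswap : ((Measure.pi D).prod (Measure.pi D)) {p | lam * (ε * L) ≤ φ p.2 - φ p.1} ≤
        ENNReal.ofReal ((Fintype.card V : ℝ) ^ (-(1 / (16 * c)))) := by
      have := (Measure.measurePreserving_swap (μ := Measure.pi D)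
        (ν := Measure.pi D)).measure_preimage_equiv (f := MeasurableEquiv.prodComm)
          {p | lam * (ε * L) ≤ φ p.1 - φ p.2}
      exact this.trans_le hle
    -- The one-sided bound yields both tails, as the two samples are exchangeable.
    refine (measure_mono fun p hp => ?_).trans ((measure_union_le _ _).trans
      ((add_le_add hle hswap).trans_eq (two_mul _).symm))
    rcases lt_abs.1 (show ε * L < |_| from hp) with hp | hp
    · right
      have := mul_lt_mul_of_pos_left hp hlam0
      simp only [Set.mem_ofPred_eq, φ]
      linarith
    · left
      have := mul_lt_mul_of_pos_left hp hlam0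
      simp only [Set.mem_ofPred_eq, φ]
      linarith
  · obtain ⟨F, hF, hm⟩ := exists_minLen_eq h (P.piecewise z x)
    have hx' : ∀ e, P.piecewise z x e ∈ Set.Icc (G.w e) (ρ * G.w e) := by
      intro e
      by_cases he : e ∈ P
      · simpa [he] using hz e
      · simpa [he] using hx e (Set.mem_univ e)
    have := mul_minLen_sub_le h (y := y) hF hm hl lam hlam0.le
      (sum_sq_le h (fun e => (hw e).le) hρ hc.le hn hx' hF hm)
    simp only [φ]
    linarith

-- The two lengths share the probed weights. An auxiliary sample z supplies these weights, so that
-- conditionally on z the lengths depend on independent samples.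
open Classical in
theorem measure_minLen_sub_piecewise_le (h : (G.edgeSets s t).Nonempty) (hw : ∀ e, 0 < G.w e)
    (hρ : 1 ≤ ρ) (hε : 0 < ε) (hc : 0 < c) (hn : 0 < Real.log (Fintype.card V))
    (hL : 0 < (G.dist s t).toReal) {D : E → Measure ℝ} [∀ e, IsProbabilityMeasure (D e)]
    (hD : ∀ e, ∀ᵐ x ∂(D e), x ∈ Set.Icc (G.w e) (ρ * G.w e)) :
    ((Measure.pi D).prod (Measure.pi D)) {p | ε * (G.dist s t).toReal <
        |minLen h p.1 - minLen h ((G.probedEdges s t ρ ε c).piecewise p.1 p.2)|} ≤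
      2 * ENNReal.ofReal ((Fintype.card V : ℝ) ^ (-(1 / (16 * c)))) := by
  set P := G.probedEdges s t ρ ε c with hP
  set μ := Measure.pi D with hμ
  have hcont : Continuous (minLen h) := by
    have := (concaveOn_minLen_piecewise h ∅ (0 : E → ℝ)).locallyLipschitz.continuous
    simpa using this
  have hpw : Measurable fun p : (E → ℝ) × (E → ℝ) => P.piecewise p.1 p.2 :=
    (measurePreserving_piecewise D P).measurable
  have hA : MeasurableSet {p : (E → ℝ) × (E → ℝ) | ε * (G.dist s t).toReal <
      |minLen h p.1 - minLen h (P.piecewise p.1 p.2)|} := by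
    have h1 : Measurable fun p : (E → ℝ) × (E → ℝ) => minLen h (P.piecewise p.1 p.2) :=
      hcont.measurable.comp hpw
    have h2 : Measurable fun p : (E → ℝ) × (E → ℝ) => minLen h p.1 :=
      hcont.measurable.comp measurable_fst
    exact measurableSet_lt measurable_const (h2.sub h1).abs
  -- Replacing the first sample by one assembled from z and p.1 does not change the joint law.
  have hT : MeasurePreserving
      (fun p : (E → ℝ) × ((E → ℝ) × (E → ℝ)) => (P.piecewise p.1 p.2.1, p.2.2))
      (μ.prod (μ.prod μ)) (μ.prod μ) :=
    ((measurePreserving_piecewise D P).prod (MeasurePreserving.id μ)).comp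
      (measurePreserving_prodAssoc μ μ μ).symm
  rw [← hT.measure_preimage hA.nullMeasurableSet, Measure.prod_apply (hT.measurable hA)]
  refine (lintegral_mono_ae (g := fun _ =>
    2 * ENNReal.ofReal ((Fintype.card V : ℝ) ^ (-(1 / (16 * c))))) ?_).trans_eq (by simp)
  filter_upwards [ae_mem_univ_pi hD] with z hz
  refine le_trans (measure_mono fun p hp => ?_)
    (measure_minLen_sub_le h hw hρ hε hc hn hL hD fun e => hz e (Set.mem_univ e))
  have : P.piecewise (P.piecewise z p.1) p.2 = P.piecewise z p.2 := by
    ext e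
    by_cases he : e ∈ P <;> simp [he]
  simpa [this] using hp

theorem measure_not_approximates_le (hw : ∀ e, 0 < G.w e) (hst : G.dist s t ≠ ⊤)
    (hρ : 1 ≤ ρ) (hε : 0 < ε) (hc : 0 < c) (D : E → Measure ℝ) [∀ e, IsProbabilityMeasure (D e)]
    (hD : ∀ e, ∀ᵐ x ∂(D e), x ∈ Set.Icc (G.w e) (ρ * G.w e)) :
    ((Measure.pi D).prod (Measure.pi D))
        {ω | ¬ (G.approximateLength s t ρ ε c ω.1 ω.2 ≠ ⊤ ∧
          |(G.approximateLength s t ρ ε c ω.1 ω.2).toReal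
              - ((G.reweight ω.1).dist s t).toReal| ≤
            ε * ((G.reweight ω.1).dist s t).toReal)} ≤
      ENNReal.ofReal (8 * (Fintype.card V : ℝ) ^ (-(1 / (16 * c)))) := by
  classical
  by_cases hne : s = t
  · subst hne
    simp [approximateLength, dist_self]
  have h := edgeSets_nonempty hst
  have hL : 0 < (G.dist s t).toReal :=
    ENNReal.toReal_pos (fun h0 => hne (eq_of_dist_eq_zero hw h0)) hst
  have hn : 0 < Real.log (Fintype.card V) := by
    have : 1 < Fintype.card V := Fintype.one_lt_card_iff.2 ⟨s, t, hne⟩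
    exact Real.log_pos (by exact_mod_cast this)
  have hω : ∀ᵐ ω ∂(Measure.pi D).prod (Measure.pi D),
      (∀ e, ω.1 e ∈ Set.Icc (G.w e) (ρ * G.w e)) ∧ ∀ e, ω.2 e ∈ Set.Icc (G.w e) (ρ * G.w e) := by
    have h1 := (Measure.quasiMeasurePreserving_fst (μ := Measure.pi D)
      (ν := Measure.pi D)).ae (ae_mem_univ_pi hD)
    have h2 := (Measure.quasiMeasurePreserving_snd (μ := Measure.pi D)
      (ν := Measure.pi D)).ae (ae_mem_univ_pi hD)
    filter_upwards [h1, h2] with ω h1 h2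
    exact ⟨fun e => h1 e (Set.mem_univ e), fun e => h2 e (Set.mem_univ e)⟩
  refine (measure_mono_ae ?_).trans
    ((measure_minLen_sub_piecewise_le h hw hρ hε hc hn hL hD).trans ?_)
  · filter_upwards [hω] with ω hω hbad
    by_contra hgood
    refine hbad ⟨?_, ?_⟩
    · rw [approximateLength_eq h (fun e => (hw e).le) ε c hω.1 hω.2]
      exact ENNReal.ofReal_ne_top
    · have h0 : ∀ e, 0 ≤ ω.1 e := fun e => (hw e).le.trans (hω.1 e).1
      have h0' : ∀ e, 0 ≤ (G.probedEdges s t ρ ε c).piecewise ω.1 ω.2 e := by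
        intro e
        by_cases he : e ∈ G.probedEdges s t ρ ε c
        · simpa [he] using h0 e
        · simpa [he] using (hw e).le.trans (hω.2 e).1
      rw [approximateLength_eq h (fun e => (hw e).le) ε c hω.1 hω.2, dist_reweight_eq h h0,
        ENNReal.toReal_ofReal (minLen_nonneg h h0), ENNReal.toReal_ofReal (minLen_nonneg h h0'),
        abs_sub_comm]
      refine (not_lt.1 hgood).trans (mul_le_mul_of_nonneg_left ?_ hε.le)
      -- The weights only increase from G to G', so an error of εL is at most εδ.
      rw [toReal_dist_eq h fun e => (hw e).le]
      exact minLen_mono h fun e => (hω.1 e).1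
  -- The concentration bound has the factor 2, well below the 8 required.
  · rw [ENNReal.ofReal_mul (by norm_num)]
    gcongr
    simp only [ENNReal.ofReal_ofNat]
    norm_num

end Concentration

end WGraph
end

theorem theorem2 (c : ℝ) (hc : 0 < c) (hc' : c ≤ 1 / 16) :
    ∃ C : ℝ, 0 < C ∧
      ∀ (V : Type*) (E : Type*) [Fintype V] [Fintype E] (G : WGraph V E)
        (_ : ∀ e, G.src e ≠ G.tgt e) (_ : ∀ e, 0 < G.w e)
        (s t : V) (_ : G.dist s t ≠ ⊤)
        (ρ ε : ℝ) (_ : 1 ≤ ρ) (_ : 0 < ε)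
        (D : E → Measure ℝ) [∀ e, IsProbabilityMeasure (D e)]
        (_ : ∀ e, ∀ᵐ x ∂(D e), x ∈ Set.Icc (G.w e) (ρ * G.w e)),
        (∀ h : ℝ, G.HasCDD h → 3 ≤ Fintype.card V → ε ≤ 1 →
          ((G.probedEdges s t ρ ε c).ncard : ℝ) ≤
            (ρ * Real.log (Fintype.card V) / ε) ^ (C * h)) ∧
        ((Measure.pi D).prod (Measure.pi D))
            {ω | ¬ (G.approximateLength s t ρ ε c ω.1 ω.2 ≠ ⊤ ∧
              |(G.approximateLength s t ρ ε c ω.1 ω.2).toReal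
                  - ((G.reweight ω.1).dist s t).toReal| ≤
                ε * ((G.reweight ω.1).dist s t).toReal)} ≤
          ENNReal.ofReal (8 * (Fintype.card V : ℝ) ^ (-(1 / (16 * c)))) := by
  have hlog : 0 < Real.log (Real.log 3) := Real.log_pos WGraph.one_lt_log_three
  have hc32 : 0 ≤ Real.log (32 / c) :=
    Real.log_nonneg (by rw [le_div_iff₀ hc]; linarith)
  refine ⟨2 * (8 + Real.log (32 / c) / Real.log (Real.log 3)), by positivity, ?_⟩
  intro V E _ _ G hl hw s t hst ρ ε hρ hε D _ hD
  exact ⟨fun h hG hV hε' =>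
      WGraph.ncard_probedEdges_le hl hw hρ hε hε' hc (by linarith) hG hV,
    WGraph.measure_not_approximates_le hw hst hρ hε hc D hD⟩
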